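/- Let $p$ be a prime, $k$ a finite field of characteristic $p$ and $d,e\ge 0$ integers. (In the application $k$ is the residue field and $e$ the ramification index of a finite extension $K/\mathbb{Q}_p$, so that $u^e$ is, up to a unit, the reduction modulo $p$ of the Eisenstein polynomial $E(u)$ of a uniformizer.) For an $\mathbb{F}_p$-algebra $R$ let $R_k=R\otimes_{\mathbb{F}_p}k$, and let $\phi$ be the endomorphism of $R_k((u))$ that is the identity on $R$, the Frobenius on $k$, and maps $u$ to $u^p$. Let $\mathcal{R}(R)$ be the groupoid of pairs $(M,\Phi)$, where $M$ is an $R_k((u))$-module that is fpqc-locally on $\operatorname{Spec} R$ free of rank $d$, and $\Phi:\phi^*M\to M$ is an isomorphism of $R_k((u))$-modules. Let $l$ be a finite field containing $k$, let $\mathcal{O}_F=l[[\varpi]]$ and $A_n=\mathcal{O}_F/(\varpi^{n+1})\otimes_{\mathbb{F}_p}k$ for $n\ge 0$. Let $\operatorname{Spf}\mathcal{O}_F\to\widehat{\mathcal{R}}$ be a formal point, that is, a sequence of objects $(M_n,\Phi_n)\in\mathcal{R}(\mathcal{O}_F/(\varpi^{n+1}))$, $n\ge 0$, together with isomorphisms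 between the reduction of $(M_{n+1},\Phi_{n+1})$ modulo $\varpi^{n+1}$ and $(M_n,\Phi_n)$. Assume that for every $n$ there is a finitely generated $A_n[[u]]$-submodule $\mathfrak{M}_n\subset M_n$ such that $\mathfrak{M}_n[1/u]=M_n$ and $$u^e\mathfrak{M}_n\subset\Phi_n(\phi^*\mathfrak{M}_n)\subset\mathfrak{M}_n,$$ where $\Phi_n(\phi^*\mathfrak{M}_n)$ denotes the image of $\phi^*\mathfrak{M}_n\to\phi^*M_n\to M_n$. (The $\mathfrak{M}_n$ are not required to be free, or compatible for varying $n$.) Then there exist $(M,\Phi)\in\mathcal{R}(\mathcal{O}_F)$ and, for every $n\ge 0$, an isomorphism between the reduction of $(M,\Phi)$ modulo $\varpi^{n+1}$ and $(M_n,\Phi_n)$, and these isomorphisms are compatible with the given transition isomorphisms. -/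

import Mathlib

open scoped TensorProduct

universe u

noncomputable section

/-! ### Extension of scalars along a ring homomorphism

A type synonym is used because the ring homomorphism may be an endomorphism of one and the
same ring, as for the Frobenius. -/

section ScalarExtension

universe u₁ u₂ u₃

variable {A : Type u₁} {B : Type u₂} [CommRing A] [CommRing B] (f : A →+* B)
  (M : Type u₃) [AddCommGroup M] [Module A M]

/-- The `B`-module `f^* M = B ⊗_{A, f} M`. -/
def ScalarExtension : Type (max u₂ u₃) :=
  letI : Algebra A B := f.toAlgebra
  B ⊗[A] M

instance ScalarExtension.instAddCommGroup : AddCommGroup (ScalarExtension f M) :=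
  letI : Algebra A B := f.toAlgebra
  (inferInstance : AddCommGroup (B ⊗[A] M))

instance ScalarExtension.instModule : Module B (ScalarExtension f M) :=
  letI : Algebra A B := f.toAlgebra
  (inferInstance : Module B (B ⊗[A] M))

variable {M}

/-- The pure tensor `b ⊗ m` in `f^* M`. -/
def ScalarExtension.tmul (b : B) (m : M) : ScalarExtension f M :=
  letI : Algebra A B := f.toAlgebra
  b ⊗ₜ[A] m

end ScalarExtension

/-! ### The coefficient rings -/

section Rings

variable (p : ℕ) [Fact p.Prime] (k : Type u) [Field k] [Algebra (ZMod p) k]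

/-- For an `𝔽_p`-algebra `R`, the ring `R ⊗_{𝔽_p} k`. It is `R ⊗_{ℤ_p} W(k)`, because `p = 0` in
`R` and `W(k) / p = k`. -/
abbrev CoeffRing (R : Type u) [CommRing R] [Algebra (ZMod p) R] : Type u := R ⊗[ZMod p] k

/-- The ring `(R ⊗ k)[[u]]`. -/
abbrev IntegralRing (R : Type u) [CommRing R] [Algebra (ZMod p) R] : Type u :=
  PowerSeries (CoeffRing p k R)

/-- The ring `(R ⊗ k)((u))`. -/
abbrev LaurentRing (R : Type u) [CommRing R] [Algebra (ZMod p) R] : Type u :=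
  LaurentSeries (CoeffRing p k R)

/-- Application of a ring homomorphism to the coefficients of a Laurent series. -/
def laurentMap {A B : Type u} [CommRing A] [CommRing B] (f : A →+* B) :
    LaurentSeries A →+* LaurentSeries B where
  toFun x := x.map f
  map_one' := by ext n; by_cases h : n = 0 <;> simp [HahnSeries.coeff_one, h]
  map_mul' x y := HahnSeries.map_mul (f : A →ₙ+* B)
  map_zero' := by ext n; simp
  map_add' x y := by ext n; simp

/-- The substitution `u ↦ u^p` on Laurent series. -/
def laurentExpand (A : Type u) [CommRing A] : LaurentSeries A →+* LaurentSeries A :=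
  HahnSeries.embDomainRingHom (AddMonoidHom.mulLeft (p : ℤ))
    (fun _ _ h => mul_left_cancel₀
      (Int.natCast_ne_zero.mpr (Fact.out : p.Prime).ne_zero) h)
    (fun _ _ => mul_le_mul_iff_right₀
      (Int.natCast_pos.mpr (Fact.out : p.Prime).pos))

/-- The homomorphism `id ⊗ Frob` of `R ⊗ k`, where `Frob` is `x ↦ x^p` on `k`. -/
def coeffFrobenius (R : Type u) [CommRing R] [Algebra (ZMod p) R] :
    CoeffRing p k R →+* CoeffRing p k R :=
  (Algebra.TensorProduct.map (AlgHom.id (ZMod p) R)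
    (FiniteField.frobeniusAlgHom (ZMod p) k)).toRingHom

/-- The endomorphism `φ` of `(R ⊗ k)((u))`: the identity on `R`, the Frobenius on `k`, and
`u ↦ u^p`. -/
def phi (R : Type u) [CommRing R] [Algebra (ZMod p) R] :
    LaurentRing p k R →+* LaurentRing p k R :=
  (laurentExpand p (CoeffRing p k R)).comp (laurentMap (coeffFrobenius p k R))

theorem phi_single (R : Type u) [CommRing R] [Algebra (ZMod p) R] (n : ℤ) (r : R) (a : k) :
    phi p k R (HahnSeries.single n (r ⊗ₜ[ZMod p] a)) =
      HahnSeries.single ((p : ℤ) * n) (r ⊗ₜ[ZMod p] (a ^ p)) := by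
  have h1 : laurentMap (coeffFrobenius p k R) (HahnSeries.single n (r ⊗ₜ[ZMod p] a)) =
      HahnSeries.single n (r ⊗ₜ[ZMod p] (a ^ p)) := by
    ext m
    by_cases h : m = n <;>
      simp [laurentMap, coeffFrobenius, h, ZMod.card]
  rw [phi, RingHom.comp_apply, h1]
  exact HahnSeries.embDomain_single

/-- The homomorphism `(R ⊗ k)((u)) → (S ⊗ k)((u))` induced by `R → S`. -/
def laurentBaseChange {R S : Type u} [CommRing R] [Algebra (ZMod p) R] [CommRing S]
    [Algebra (ZMod p) S] (f : R →ₐ[ZMod p] S) : LaurentRing p k R →+* LaurentRing p k S :=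
  laurentMap (Algebra.TensorProduct.map f (AlgHom.id (ZMod p) k)).toRingHom

/-- The `(R ⊗ k)((u))`-module `M` is, fpqc-locally on `Spec R`, free of rank `d`. -/
def IsFpqcLocallyFree (d : ℕ) (R : Type u) [CommRing R] [Algebra (ZMod p) R]
    (M : Type u) [AddCommGroup M] [Module (LaurentRing p k R) M] : Prop :=
  ∃ (R' : Type u) (_ : CommRing R') (_ : Algebra (ZMod p) R') (f : R →ₐ[ZMod p] R'),
    f.toRingHom.FaithfullyFlat ∧
      Nonempty (ScalarExtension (laurentBaseChange p k f) M ≃ₗ[LaurentRing p k R']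
        (Fin d → LaurentRing p k R'))

end Rings

/-! ### Étale `φ`-modules -/

/-- An object `(M, Φ)` of the groupoid `ℛ(R)`, for an `𝔽_p`-algebra `R`. -/
structure PhiModule (p : ℕ) [Fact p.Prime] (k : Type u) [Field k] [Algebra (ZMod p) k] (d : ℕ)
    (R : Type u) [CommRing R] [Algebra (ZMod p) R] where
  /-- The underlying module `M`. -/
  carrier : Type u
  [addCommGroup : AddCommGroup carrier]
  [module : Module (LaurentRing p k R) carrier]
  locallyFree : IsFpqcLocallyFree p k d R carrier
  /-- The isomorphism `Φ : φ^* M → M`. -/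
  Phi : ScalarExtension (phi p k R) carrier ≃ₗ[LaurentRing p k R] carrier

namespace PhiModule

attribute [instance] PhiModule.addCommGroup PhiModule.module

section

variable {p : ℕ} [Fact p.Prime] {k : Type u} [Field k] [Algebra (ZMod p) k] {d : ℕ}
  {R S : Type u} [CommRing R] [Algebra (ZMod p) R] [CommRing S] [Algebra (ZMod p) S]

/-- The structure of `(R ⊗ k)[[u]]`-module on `M` by restriction of scalars. -/
instance integralModule (M : PhiModule p k d R) : Module (IntegralRing p k R) M.carrier :=
  Module.compHom M.carrier (algebraMap (IntegralRing p k R) (LaurentRing p k R))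

instance (M : PhiModule p k d R) :
    IsScalarTower (IntegralRing p k R) (LaurentRing p k R) M.carrier :=
  IsScalarTower.of_algebraMap_smul fun _ _ => rfl

/-- The `φ`-semilinear map `m ↦ Φ(1 ⊗ m)` on `M`. -/
def frob (M : PhiModule p k d R) (m : M.carrier) : M.carrier :=
  M.Phi (ScalarExtension.tmul (phi p k R) 1 m)

/-- `Φ(φ^* L)` for an `(R ⊗ k)[[u]]`-submodule `L` of `M`: the image of
`φ^* L → φ^* M → M`, i.e. the `(R ⊗ k)[[u]]`-span of the elements `Φ(1 ⊗ m)`, `m ∈ L`. -/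
def phiImage (M : PhiModule p k d R) (L : Submodule (IntegralRing p k R) M.carrier) :
    Submodule (IntegralRing p k R) M.carrier :=
  Submodule.span (IntegralRing p k R) (M.frob '' (L : Set M.carrier))

/-- `L` is a finitely generated `(R ⊗ k)[[u]]`-submodule of `M` such that `L[1/u] = M` and
`u^e L ⊆ Φ(φ^* L) ⊆ L`. -/
structure IsLatticeOfHeightLEOne (M : PhiModule p k d R) (e : ℕ)
    (L : Submodule (IntegralRing p k R) M.carrier) : Prop where
  fg : L.FG
  localization : IsLocalizedModule
    (Submonoid.powers (PowerSeries.X : IntegralRing p k R)) L.subtype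
  pow_smul_mem : ∀ m ∈ L, (PowerSeries.X : IntegralRing p k R) ^ e • m ∈ M.phiImage L
  phiImage_le : M.phiImage L ≤ L

/-- An isomorphism `f^* (M, Φ) ≅ (N, Ψ)` in `ℛ(S)`, for `(M, Φ)` in `ℛ(R)`, a homomorphism
`f : R → S` and `(N, Ψ)` in `ℛ(S)`: an `(S ⊗ k)((u))`-linear isomorphism that is compatible with
the `φ`-structures (which has to be tested on the elements `1 ⊗ m` only). -/
structure BaseChangeIso (f : R →ₐ[ZMod p] S) (M : PhiModule p k d R)
    (N : PhiModule p k d S) where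
  /-- The linear isomorphism. -/
  iso : ScalarExtension (laurentBaseChange p k f) M.carrier ≃ₗ[LaurentRing p k S] N.carrier
  comm : ∀ m : M.carrier,
    iso (ScalarExtension.tmul (laurentBaseChange p k f) 1 (M.frob m)) =
      N.frob (iso (ScalarExtension.tmul (laurentBaseChange p k f) 1 m))

/-- The reduction map `M → f^* M ≅ N`. -/
def BaseChangeIso.red {f : R →ₐ[ZMod p] S} {M : PhiModule p k d R} {N : PhiModule p k d S}
    (g : BaseChangeIso f M N) (m : M.carrier) : N.carrier :=
  g.iso (ScalarExtension.tmul (laurentBaseChange p k f) 1 m)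

end

end PhiModule

/-! ### Formal points over `𝒪_F = l[[ϖ]]` -/

section Formal

variable (p : ℕ) [Fact p.Prime] (l : Type u) [Field l] [Algebra (ZMod p) l]

/-- The ring `𝒪_F / ϖ^{n+1}`, where `𝒪_F = l[[ϖ]]`. -/
abbrev TruncRing (n : ℕ) : Type u :=
  PowerSeries l ⧸ Ideal.span {(PowerSeries.X : PowerSeries l) ^ (n + 1)}

/-- The projection `𝒪_F → 𝒪_F / ϖ^{n+1}`. -/
def toTrunc (n : ℕ) : PowerSeries l →ₐ[ZMod p] TruncRing l n :=
  Ideal.Quotient.mkₐ (ZMod p) _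

/-- The projection `𝒪_F / ϖ^{n+2} → 𝒪_F / ϖ^{n+1}`. -/
def truncSucc (n : ℕ) : TruncRing l (n + 1) →ₐ[ZMod p] TruncRing l n :=
  Ideal.Quotient.factorₐ (ZMod p) (by
    rw [Ideal.span_singleton_le_span_singleton]
    exact pow_dvd_pow _ (Nat.le_succ _))

/-- A morphism `Spf 𝒪_F → ℛ^`: objects `(M_n, Φ_n)` of `ℛ(𝒪_F / ϖ^{n+1})` together with
isomorphisms of the reduction of `(M_{n+1}, Φ_{n+1})` modulo `ϖ^{n+1}` with `(M_n, Φ_n)`. -/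
structure FormalPoint (k : Type u) [Field k] [Algebra (ZMod p) k] (d : ℕ) where
  /-- The `φ`-module `(M_n, Φ_n)`. -/
  obj (n : ℕ) : PhiModule p k d (TruncRing l n)
  /-- The transition isomorphisms. -/
  trans (n : ℕ) : PhiModule.BaseChangeIso (truncSucc p l n) (obj (n + 1)) (obj n)

end Formal

end

/-! The plan is to replace the given lattices by a compatible system of free ones and then pass to
the limit of the Frobenius matrices. Write 𝔐 for a lattice of height at most `e`, that is, `u^e 𝔐 ⊆
Φ(φ^*𝔐) ⊆ 𝔐`.

Two such lattices in the same `M_n` differ by at most `u^e`: an inclusion `u^i 𝔐' ⊆ 𝔐` improves to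
`u^⌊(e+i)/p⌋ 𝔐' ⊆ 𝔐`, because Frobenius multiplies exponents of `u` by `p ≥ 2`
(`IsLatticeOfHeightLEOne.X_pow_smul_mem`). Hence `M_n` has a largest such lattice
(`isLattice_maxLattice`). The images in `M_n` of the largest lattices of `M_{n+m}` decrease with `m`
and stay between a lattice and `u^e` times it. The quotient is finite, so they stabilize. The stable
lattices map onto one another (`redImage_stableLattice`).

The crucial point is saturation: an element of the stable lattice that is divisible by `ϖ` in `M_n`
is divisible by `ϖ` in the lattice (`exists_smul_eq_of_mem_stableLattice`). It holds because
dividing a lattice of `M_{n+1}` by `ϖ` and reducing gives another lattice of height at most `e` in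
`M_n`, which the largest one contains.

For `n = 0` the coefficient ring is a finite product of fields, so the lattice is generated by `d`
elements. Saturation and Nakayama's lemma lift these generators compatibly to every `n`, and `d`
generators form a basis after inverting `u`. Frobenius then has matrices `X_n` over `A_n[[u]]` with
`X_n Y_n = u^e`. They converge to power series matrices over `𝒪_F ⊗ k` with `X Y = u^e`, so `X` is
invertible after inverting `u` and defines the required module. The uniform bound `e` is what keeps
the limit inside Laurent series. -/

noncomputable section

/-! ### Coefficientwise maps between Laurent series rings, and the power series inside them -/

section LaurentMap

variable {A B : Type u} [CommRing A] [CommRing B]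

@[simp]
theorem laurentMap_coeff (f : A →+* B) (x : LaurentSeries A) (n : ℤ) :
    (laurentMap f x).coeff n = f (x.coeff n) := rfl

theorem laurentMap_injective {f : A →+* B} (hf : Function.Injective f) :
    Function.Injective (laurentMap f) := fun x y h => by
  ext n
  exact hf (congrArg (fun z => HahnSeries.coeff z n) h)

/-- A Laurent series can be constructed coefficientwise from another one, by a relation
that relates `0` to `0`. -/
theorem LaurentSeries.exists_coeff_rel (x : LaurentSeries A) (r : A → B → Prop)
    (h0 : r 0 0) (hr : ∀ n, ∃ b, r (x.coeff n) b) :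
    ∃ y : LaurentSeries B, ∀ n, r (x.coeff n) (y.coeff n) := by
  classical
  -- Choosing `0` over every zero coefficient keeps the support of the result inside that of `x`, so
  -- it is again a Laurent series.
  have h : ∀ n, ∃ b, r (x.coeff n) b ∧ (x.coeff n = 0 → b = 0) := fun n => by
    by_cases hx : x.coeff n = 0
    · exact ⟨0, by rwa [hx], fun _ => rfl⟩
    · obtain ⟨b, hb⟩ := hr n
      exact ⟨b, hb, fun h => (hx h).elim⟩
  choose b hb hb0 using h
  refine ⟨⟨b, x.isPWO_support.mono fun n hn hx => hn (hb0 n hx)⟩, hb⟩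

theorem laurentMap_surjective {f : A →+* B} (hf : Function.Surjective f) :
    Function.Surjective (laurentMap f) := fun y => by
  obtain ⟨x, hx⟩ := LaurentSeries.exists_coeff_rel y (fun b a => f a = b) (map_zero f)
    (fun n => hf _)
  exact ⟨x, HahnSeries.ext (funext hx)⟩

theorem exists_eq_C_mul_of_laurentMap_eq_zero {f : A →+* B} {c : A}
    (hf : ∀ a, f a = 0 → ∃ b, a = c * b) {x : LaurentSeries A} (hx : laurentMap f x = 0) :
    ∃ y, x = HahnSeries.C c * y := by
  obtain ⟨y, hy⟩ := LaurentSeries.exists_coeff_rel x (fun a b => a = c * b) (by simp)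
    (fun n => hf _ (congrArg (fun z => HahnSeries.coeff z n) hx))
  refine ⟨y, HahnSeries.ext (funext fun n => ?_)⟩
  rw [HahnSeries.C_apply, HahnSeries.coeff_single_zero_mul, hy]

theorem laurentMap_eq_zero_of_C_mul_eq_zero {f : A →+* B} {c : A}
    (hf : ∀ a, c * a = 0 → f a = 0) {x : LaurentSeries A} (hx : HahnSeries.C c * x = 0) :
    laurentMap f x = 0 := by
  ext n
  have h := congrArg (fun z => HahnSeries.coeff z n) hx
  simp only [HahnSeries.C_apply, HahnSeries.coeff_single_zero_mul] at h
  exact hf _ h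

theorem algebraMap_powerSeries_coeff (s : PowerSeries A) (n : ℕ) :
    (algebraMap (PowerSeries A) (LaurentSeries A) s).coeff n = PowerSeries.coeff n s :=
  HahnSeries.ofPowerSeries_apply_coeff s n

theorem algebraMap_powerSeries_coeff_of_neg (s : PowerSeries A) {n : ℤ} (hn : n < 0) :
    (algebraMap (PowerSeries A) (LaurentSeries A) s).coeff n = 0 := by
  have := PowerSeries.coeff_coe s n
  rw [if_pos hn] at this
  exact this

theorem algebraMap_powerSeries_injective :
    Function.Injective (algebraMap (PowerSeries A) (LaurentSeries A)) :=
  HahnSeries.ofPowerSeries_injective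

theorem exists_algebraMap_powerSeries_eq {x : LaurentSeries A} (hx : ∀ n < 0, x.coeff n = 0) :
    ∃ s, algebraMap (PowerSeries A) (LaurentSeries A) s = x := by
  refine ⟨PowerSeries.mk fun n => x.coeff n, HahnSeries.ext (funext fun n => ?_)⟩
  rcases lt_or_ge n 0 with h | h
  · rw [algebraMap_powerSeries_coeff_of_neg _ h, hx n h]
  · lift n to ℕ using h
    rw [algebraMap_powerSeries_coeff, PowerSeries.coeff_mk]

theorem laurentMap_algebraMap (f : A →+* B) (s : PowerSeries A) :
    laurentMap f (algebraMap (PowerSeries A) (LaurentSeries A) s) =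
      algebraMap (PowerSeries B) (LaurentSeries B) (PowerSeries.map f s) := by
  ext n
  rw [laurentMap_coeff]
  rcases lt_or_ge n 0 with h | h
  · rw [algebraMap_powerSeries_coeff_of_neg _ h, algebraMap_powerSeries_coeff_of_neg _ h, map_zero]
  · lift n to ℕ using h
    rw [algebraMap_powerSeries_coeff, algebraMap_powerSeries_coeff, PowerSeries.coeff_map]

theorem algebraMap_X_pow (n : ℕ) :
    algebraMap (PowerSeries A) (LaurentSeries A) (PowerSeries.X ^ n) =
      HahnSeries.single (n : ℤ) 1 :=
  HahnSeries.ofPowerSeries_X_pow n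

theorem algebraMap_C (a : A) :
    algebraMap (PowerSeries A) (LaurentSeries A) (PowerSeries.C a) = HahnSeries.C a :=
  HahnSeries.ofPowerSeries_C a

theorem isUnit_algebraMap_X_pow (n : ℕ) :
    IsUnit (algebraMap (PowerSeries A) (LaurentSeries A) (PowerSeries.X ^ n)) := by
  rw [algebraMap_X_pow]
  refine IsUnit.of_mul_eq_one (HahnSeries.single (-(n : ℤ)) 1) ?_
  simp

end LaurentMap

/-! ### The decomposition `b = ∑ u^i φ(b_i)`, `0 ≤ i < p` -/

section Slices

variable (p : ℕ) [Fact p.Prime] (k : Type u) [Field k] [Algebra (ZMod p) k]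
  (R : Type u) [CommRing R] [Algebra (ZMod p) R]

theorem phi_coeff_mul (x : LaurentRing p k R) (n : ℤ) :
    (phi p k R x).coeff (p * n) = coeffFrobenius p k R (x.coeff n) := by
  have := HahnSeries.embDomain_coeff (f := ⟨⟨AddMonoidHom.mulLeft (p : ℤ),
    fun _ _ h => mul_left_cancel₀ (Int.natCast_ne_zero.mpr (Fact.out : p.Prime).ne_zero) h⟩,
    mul_le_mul_iff_right₀ (Int.natCast_pos.mpr (Fact.out : p.Prime).pos)⟩)
    (x := laurentMap (coeffFrobenius p k R) x) (a := n)
  exact this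

theorem phi_coeff_of_not_dvd (x : LaurentRing p k R) {n : ℤ} (hn : ¬ (p : ℤ) ∣ n) :
    (phi p k R x).coeff n = 0 := by
  refine HahnSeries.embDomain_of_notMem_range ?_
  rintro ⟨m, rfl⟩
  exact hn ⟨m, rfl⟩

theorem coeffFrobenius_bijective [Finite k] : Function.Bijective (coeffFrobenius p k R) := by
  have : Function.Bijective (FiniteField.frobeniusAlgHom (ZMod p) k) :=
    (FiniteField.frobeniusAlgEquivOfAlgebraic (ZMod p) k).bijective
  let E := Algebra.TensorProduct.congr (AlgEquiv.refl (R := ZMod p) (A₁ := R))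
    (AlgEquiv.ofBijective _ this)
  have hE : ∀ x, coeffFrobenius p k R x = E x := fun x => rfl
  exact (funext hE : ⇑(coeffFrobenius p k R) = E) ▸ E.bijective

theorem phi_algebraMap_X_pow (n : ℕ) :
    phi p k R (algebraMap (IntegralRing p k R) (LaurentRing p k R) (PowerSeries.X ^ n)) =
      algebraMap (IntegralRing p k R) (LaurentRing p k R) (PowerSeries.X ^ (p * n)) := by
  rw [algebraMap_X_pow, algebraMap_X_pow]
  have := phi_single p k R n 1 1
  rwa [one_pow, ← Algebra.TensorProduct.one_def, ← Nat.cast_mul] at this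

theorem phi_C_tmul_one (r : R) :
    phi p k R (HahnSeries.C (r ⊗ₜ[ZMod p] (1 : k))) = HahnSeries.C (r ⊗ₜ[ZMod p] (1 : k)) := by
  simpa using phi_single p k R 0 r 1

/-- The `i`-th summand has exponents congruent to `i` modulo `p` only, so each exponent sees a
single summand. -/
theorem coeff_sum_X_pow_mul_phi (x : Fin p → LaurentRing p k R) (n : ℤ) (j : Fin p) :
    (∑ i : Fin p, algebraMap (IntegralRing p k R) (LaurentRing p k R) (PowerSeries.X ^ (i : ℕ)) *
      phi p k R (x i)).coeff (p * n + (j : ℕ)) = coeffFrobenius p k R ((x j).coeff n) := by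
  rw [HahnSeries.coeff_sum, Finset.sum_eq_single j]
  · rw [algebraMap_X_pow, HahnSeries.coeff_single_mul, one_mul, add_sub_cancel_right,
      phi_coeff_mul]
  · intro i _ hij
    rw [algebraMap_X_pow, HahnSeries.coeff_single_mul, one_mul]
    refine phi_coeff_of_not_dvd p k R _ fun h => hij (Fin.ext ?_)
    rw [add_sub_assoc, dvd_add_right (dvd_mul_right _ _)] at h
    have hi := i.isLt
    have hj := j.isLt
    obtain ⟨c, hc⟩ := h
    have h1 : (p : ℤ) * c < p * 1 := by omega
    have h2 : (p : ℤ) * (-1) < p * c := by omega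
    have hp : (0 : ℤ) < p := by omega
    have h3 := lt_of_mul_lt_mul_left h1 hp.le
    have h4 := lt_of_mul_lt_mul_left h2 hp.le
    obtain rfl : c = 0 := by omega
    omega
  · simp

variable {p k R} in
theorem slices_unique [Finite k] {x y : Fin p → LaurentRing p k R}
    (h : ∑ i : Fin p, algebraMap (IntegralRing p k R) (LaurentRing p k R)
        (PowerSeries.X ^ (i : ℕ)) * phi p k R (x i) =
      ∑ i : Fin p, algebraMap (IntegralRing p k R) (LaurentRing p k R)
        (PowerSeries.X ^ (i : ℕ)) * phi p k R (y i)) : x = y := by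
  funext j
  ext n
  apply (coeffFrobenius_bijective p k R).1
  rw [← coeff_sum_X_pow_mul_phi, h, coeff_sum_X_pow_mul_phi]

-- The slices are read off from the coefficients at `p n + i` by inverting the Frobenius of `k`,
-- which is bijective as `k` is finite. The second clause holds because `p n + i < 0` for `n < 0`;
-- it makes the slices of a power series power series.
variable {p k R} in
theorem exists_slices [Finite k] (b : LaurentRing p k R) :
    ∃ x : Fin p → LaurentRing p k R,
      (∑ i : Fin p, algebraMap (IntegralRing p k R) (LaurentRing p k R)
        (PowerSeries.X ^ (i : ℕ)) * phi p k R (x i) = b) ∧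
      ((∀ n < 0, b.coeff n = 0) → ∀ i, ∀ n < 0, (x i).coeff n = 0) := by
  have hp : (0 : ℤ) < p := Int.natCast_pos.mpr (Fact.out : p.Prime).pos
  let F := Equiv.ofBijective _ (coeffFrobenius_bijective p k R)
  have hF : ∀ a, coeffFrobenius p k R (F.symm a) = a := F.apply_symm_apply
  have hF0 : F.symm 0 = 0 := (Equiv.symm_apply_eq F).2 (map_zero (coeffFrobenius p k R)).symm
  obtain ⟨N, hN⟩ : ∃ N : ℤ, ∀ n < N, b.coeff n = 0 :=
    ⟨b.order, fun n hn => HahnSeries.coeff_eq_zero_of_lt_order hn⟩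
  have hneg : ∀ (i : Fin p) (n : ℤ), n < 0 → (p : ℤ) * n + (i : ℕ) < 0 := fun i n hn => by
    have := i.isLt
    nlinarith
  let x : Fin p → LaurentRing p k R := fun i =>
    HahnSeries.ofSuppBddBelow (fun n => F.symm (b.coeff (p * n + (i : ℕ)))) <| by
      refine ⟨-|N| - 1, fun n hn => ?_⟩
      by_contra hlt
      refine hn ?_
      have := i.isLt
      have h1 := neg_abs_le N
      have h2 := abs_nonneg N
      change F.symm _ = 0
      rw [hN _ (by nlinarith), hF0]
  have hx : ∀ i n, (x i).coeff n = F.symm (b.coeff (p * n + (i : ℕ))) := fun _ _ => rfl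
  refine ⟨x, HahnSeries.ext (funext fun n => ?_), fun hb i n hn => ?_⟩
  · have hmod := Int.emod_nonneg n hp.ne'
    have hlt := Int.emod_lt_of_pos n hp
    have key : n = p * (n / p) + ((⟨(n % p).toNat, by omega⟩ : Fin p) : ℕ) := by
      have := Int.mul_ediv_add_emod n p
      simp only [Int.toNat_of_nonneg hmod]
      omega
    rw [key, coeff_sum_X_pow_mul_phi, hx, hF]
  · rw [hx, hb _ (hneg i n hn), hF0]

variable {p k R} in
theorem exists_integral_slices [Finite k] (s : IntegralRing p k R) :
    ∃ x : Fin p → IntegralRing p k R,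
      ∑ i : Fin p, algebraMap (IntegralRing p k R) (LaurentRing p k R) (PowerSeries.X ^ (i : ℕ)) *
        phi p k R (algebraMap (IntegralRing p k R) (LaurentRing p k R) (x i)) =
      algebraMap (IntegralRing p k R) (LaurentRing p k R) s := by
  obtain ⟨x, hx, hx'⟩ := exists_slices (algebraMap (IntegralRing p k R) (LaurentRing p k R) s)
  have h := fun i => exists_algebraMap_powerSeries_eq
    (hx' (fun n hn => algebraMap_powerSeries_coeff_of_neg s hn) i)
  choose y hy using h
  exact ⟨y, by simpa only [hy] using hx⟩

/-- The components of a Laurent series with respect to the decomposition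
`b = ∑ i < p, u ^ i φ (b_i)`. -/
def slice [Finite k] (i : Fin p) : LaurentRing p k R →+ LaurentRing p k R where
  toFun b := (exists_slices b).choose i
  map_zero' := by
    have h := (exists_slices (0 : LaurentRing p k R)).choose_spec.1
    exact congrFun (slices_unique (y := 0) (h.trans (by simp))) i
  map_add' a b := by
    have h := (exists_slices (a + b)).choose_spec.1
    have ha := (exists_slices a).choose_spec.1
    have hb := (exists_slices b).choose_spec.1
    refine congrFun (slices_unique (y := (exists_slices a).choose + (exists_slices b).choose)
      (h.trans ?_)) i
    simp only [Pi.add_apply, map_add, mul_add, Finset.sum_add_distrib, ha, hb]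

theorem sum_slice [Finite k] (b : LaurentRing p k R) :
    ∑ i : Fin p, algebraMap (IntegralRing p k R) (LaurentRing p k R) (PowerSeries.X ^ (i : ℕ)) *
      phi p k R (slice p k R i b) = b :=
  (exists_slices b).choose_spec.1

theorem slice_phi_mul [Finite k] (i : Fin p) (a b : LaurentRing p k R) :
    slice p k R i (phi p k R a * b) = a * slice p k R i b := by
  refine congrFun (slices_unique (x := fun i => slice p k R i (phi p k R a * b))
    (y := fun i => a * slice p k R i b) ?_) i
  rw [sum_slice]
  conv_lhs => rw [← sum_slice p k R b, Finset.mul_sum]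
  exact Finset.sum_congr rfl fun j _ => by rw [map_mul]; ring

theorem slice_X_pow [Finite k] (i j : Fin p) :
    slice p k R i (algebraMap (IntegralRing p k R) (LaurentRing p k R)
      (PowerSeries.X ^ (j : ℕ))) = if i = j then 1 else 0 := by
  refine congrFun (slices_unique (x := fun i => slice p k R i _)
    (y := fun i => if i = j then 1 else 0) ?_) i
  rw [sum_slice, Finset.sum_eq_single j] <;> simp +contextual

end Slices

/-! ### Calculus of extension of scalars -/

namespace ScalarExtension

universe u₁ u₂ u₃

variable {A : Type u₁} {B : Type u₂} [CommRing A] [CommRing B] (f : A →+* B)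
  {M : Type u₃} [AddCommGroup M] [Module A M]

theorem tmul_add (b : B) (m m' : M) : tmul f b (m + m') = tmul f b m + tmul f b m' :=
  let : Algebra A B := f.toAlgebra
  TensorProduct.tmul_add b m m'

theorem smul_tmul (c b : B) (m : M) : c • tmul f b m = tmul f (c * b) m := rfl

theorem tmul_smul (b : B) (a : A) (m : M) : tmul f b (a • m) = tmul f (b * f a) m := by
  let : Algebra A B := f.toAlgebra
  change b ⊗ₜ[A] (a • m) = (b * algebraMap A B a) ⊗ₜ[A] m
  rw [TensorProduct.tmul_smul, TensorProduct.smul_tmul', Algebra.smul_def, mul_comm]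

theorem tmul_eq_smul (b : B) (m : M) : tmul f b m = b • tmul f 1 m := by
  rw [smul_tmul, mul_one]

variable {f} in
@[elab_as_elim]
theorem induction_on {motive : ScalarExtension f M → Prop} (x : ScalarExtension f M)
    (zero : motive 0) (tmul : ∀ b m, motive (tmul f b m))
    (add : ∀ x y, motive x → motive y → motive (x + y)) : motive x :=
  let : Algebra A B := f.toAlgebra
  TensorProduct.induction_on (motive := motive) x zero tmul add

/-- The additive map out of `f^* M` defined by a balanced biadditive map. -/
def liftAddHom {P : Type*} [AddCommGroup P] (g : B →+ M →+ P)
    (hg : ∀ a b m, g (b * f a) m = g b (a • m)) : ScalarExtension f M →+ P :=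
  letI : Algebra A B := f.toAlgebra
  TensorProduct.liftAddHom g fun a b m => by
    rw [Algebra.smul_def, mul_comm]
    exact hg a b m

theorem liftAddHom_tmul {P : Type*} [AddCommGroup P] (g : B →+ M →+ P)
    (hg : ∀ a b m, g (b * f a) m = g b (a • m)) (b : B) (m : M) :
    liftAddHom f g hg (tmul f b m) = g b m := rfl

variable {f} in
/-- Every element is a pure tensor when `f` is surjective. -/
theorem exists_eq_tmul_one (hf : Function.Surjective f) (x : ScalarExtension f M) :
    ∃ m, tmul f 1 m = x := by
  induction x using induction_on with
  | zero => exact ⟨0, map_zero (AddMonoidHom.mk' (tmul f (1 : B) : M → _) (tmul_add f 1))⟩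
  | tmul b m =>
    obtain ⟨a, rfl⟩ := hf b
    exact ⟨a • m, by rw [tmul_smul, one_mul]⟩
  | add x y hx hy =>
    obtain ⟨m, rfl⟩ := hx
    obtain ⟨m', rfl⟩ := hy
    exact ⟨m + m', tmul_add f 1 m m'⟩

variable {f} in
/-- If `f` is surjective, then the kernel of `M → f^* M` is generated by the kernel of `f`. -/
theorem mem_of_tmul_one_eq_zero (hf : Function.Surjective f) {m : M} (hm : tmul f 1 m = 0)
    (P : Submodule A M) (hP : ∀ a, f a = 0 → ∀ m : M, a • m ∈ P) : m ∈ P := by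
  have hs : ∀ b, f (hf b).choose = b := fun b => (hf b).choose_spec
  have hrel : ∀ a b, f a = f b → ∀ m : M, P.mkQ (a • m) = P.mkQ (b • m) := fun a b h m => by
    rw [← sub_eq_zero, ← map_sub, ← sub_smul, Submodule.mkQ_apply, Submodule.Quotient.mk_eq_zero]
    exact hP _ (by rw [map_sub, h, sub_self]) m
  -- A set-theoretic section of `f` gives a balanced biadditive map into `M ⧸ P`, since different
  -- lifts of the same element of `B` differ by `ker f`, which sends `M` into `P`. The induced map
  -- on `f^* M` takes `1 ⊗ m` to the class of `m`.
  let g : B →+ M →+ M ⧸ P := AddMonoidHom.mk'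
    (fun b => AddMonoidHom.mk' (fun m => P.mkQ ((hf b).choose • m)) fun m m' => by
      rw [smul_add, map_add])
    (fun b b' => AddMonoidHom.ext fun m => by
      change P.mkQ _ = P.mkQ _ + P.mkQ _
      rw [← map_add, ← add_smul]
      exact hrel _ _ (by rw [hs, map_add, hs, hs]) m)
  have hg : ∀ a b m, g (b * f a) m = g b (a • m) := fun a b m => by
    change P.mkQ _ = P.mkQ _
    rw [smul_smul]
    exact hrel _ _ (by rw [hs, map_mul, hs]) m
  have h := liftAddHom_tmul f g hg 1 m
  rw [hm, map_zero] at h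
  have h1 : P.mkQ ((hf 1).choose • m) = P.mkQ ((1 : A) • m) :=
    hrel _ _ (by rw [hs, map_one]) m
  rw [one_smul] at h1
  rw [← Submodule.Quotient.mk_eq_zero]
  exact h1.symm.trans h.symm

/-- `f^* (A^n) = B^n`. -/
def piEquiv (ι : Type) [Fintype ι] [DecidableEq ι] : ScalarExtension f (ι → A) ≃ₗ[B] (ι → B) :=
  letI : Algebra A B := f.toAlgebra
  TensorProduct.piScalarRight A B B ι

theorem piEquiv_tmul (ι : Type) [Fintype ι] [DecidableEq ι] (b : B) (m : ι → A) :
    piEquiv f ι (tmul f b m) = fun i => b * f (m i) := by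
  let : Algebra A B := f.toAlgebra
  have := TensorProduct.piScalarRightHom_tmul A B B ι b m
  refine this.trans (funext fun i => ?_)
  rw [Algebra.smul_def, mul_comm]
  rfl

end ScalarExtension

/-! ### The semilinear Frobenius and the submodule it generates -/

namespace PhiModule

variable {p : ℕ} [Fact p.Prime] {k : Type u} [Field k] [Algebra (ZMod p) k] {d : ℕ}
  {R : Type u} [CommRing R] [Algebra (ZMod p) R] (M : PhiModule p k d R)

theorem integral_smul_def (s : IntegralRing p k R) (m : M.carrier) :
    s • m = algebraMap (IntegralRing p k R) (LaurentRing p k R) s • m := rfl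

theorem frob_add (m m' : M.carrier) : M.frob (m + m') = M.frob m + M.frob m' := by
  rw [frob, ScalarExtension.tmul_add, map_add]; rfl

theorem frob_smul (b : LaurentRing p k R) (m : M.carrier) :
    M.frob (b • m) = phi p k R b • M.frob m := by
  rw [frob, ScalarExtension.tmul_smul, one_mul, ScalarExtension.tmul_eq_smul, map_smul]; rfl

theorem frob_zero : M.frob 0 = 0 :=
  map_zero (AddMonoidHom.mk' M.frob M.frob_add)

theorem frob_sum {ι : Type*} (s : Finset ι) (m : ι → M.carrier) :
    M.frob (∑ i ∈ s, m i) = ∑ i ∈ s, M.frob (m i) :=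
  map_sum (AddMonoidHom.mk' M.frob M.frob_add) m s

theorem frob_X_pow_smul (n : ℕ) (m : M.carrier) :
    M.frob ((PowerSeries.X ^ n : IntegralRing p k R) • m) =
      (PowerSeries.X ^ (p * n) : IntegralRing p k R) • M.frob m := by
  rw [integral_smul_def, frob_smul, phi_algebraMap_X_pow, integral_smul_def]

theorem X_pow_smul_injective (n : ℕ) {m m' : M.carrier}
    (h : (PowerSeries.X ^ n : IntegralRing p k R) • m =
      (PowerSeries.X ^ n : IntegralRing p k R) • m') : m = m' :=
  (IsUnit.smul_left_cancel (isUnit_algebraMap_X_pow n)).1 h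

theorem exists_X_pow_smul_eq (n : ℕ) (m : M.carrier) :
    ∃ m', (PowerSeries.X ^ n : IntegralRing p k R) • m' = m := by
  obtain ⟨v, hv⟩ := isUnit_algebraMap_X_pow (A := CoeffRing p k R) n
  refine ⟨(↑v⁻¹ : LaurentRing p k R) • m, ?_⟩
  rw [integral_smul_def, smul_smul, ← hv, Units.mul_inv, one_smul]

section Finite

variable [Finite k]

/-- Every element can be written as `∑ i < p, u ^ i Φ(1 ⊗ m_i)`. -/
theorem exists_sum_frob (m : M.carrier) : ∃ x : Fin p → M.carrier,
    ∑ i : Fin p, (PowerSeries.X ^ (i : ℕ) : IntegralRing p k R) • M.frob (x i) = m := by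
  have key : ∀ t : ScalarExtension (phi p k R) M.carrier, ∃ x : Fin p → M.carrier,
      ∑ i : Fin p, (PowerSeries.X ^ (i : ℕ) : IntegralRing p k R) • M.frob (x i) = M.Phi t := by
    intro t
    induction t using ScalarExtension.induction_on with
    | zero => exact ⟨0, by simp [frob_zero]⟩
    | tmul b m =>
      refine ⟨fun i => slice p k R i b • m, ?_⟩
      rw [ScalarExtension.tmul_eq_smul, map_smul]
      change _ = b • M.frob m
      conv_rhs => rw [← sum_slice p k R b, Finset.sum_smul]
      exact Finset.sum_congr rfl fun i _ => by rw [frob_smul, integral_smul_def, smul_smul]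
    | add x y hx hy =>
      obtain ⟨a, ha⟩ := hx
      obtain ⟨b, hb⟩ := hy
      refine ⟨a + b, ?_⟩
      simp only [Pi.add_apply, frob_add, smul_add, Finset.sum_add_distrib, ha, hb, map_add]
  simpa using key (M.Phi.symm m)

variable {M} in
/-- The decomposition `m = ∑ i < p, u ^ i Φ(1 ⊗ m_i)` is unique. -/
theorem sum_frob_injective {x y : Fin p → M.carrier}
    (h : ∑ i : Fin p, (PowerSeries.X ^ (i : ℕ) : IntegralRing p k R) • M.frob (x i) =
      ∑ i : Fin p, (PowerSeries.X ^ (i : ℕ) : IntegralRing p k R) • M.frob (y i)) : x = y := by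
  funext j
  -- The map `b ⊗ m ↦ b_j m`, with `b_j` the `j`-th slice of `b`, is well defined on `φ^* M` and
  -- extracts the `j`-th component.
  let g : LaurentRing p k R →+ M.carrier →+ M.carrier :=
    (smulAddHom (LaurentRing p k R) M.carrier).comp (slice p k R j)
  have hg : ∀ a b m, g (b * phi p k R a) m = g b (a • m) := fun a b m => by
    change slice p k R j _ • m = slice p k R j b • a • m
    rw [mul_comm, slice_phi_mul, smul_smul, mul_comm]
  have key : ∀ z : Fin p → M.carrier, ScalarExtension.liftAddHom (phi p k R) g hg (M.Phi.symm
      (∑ i : Fin p, (PowerSeries.X ^ (i : ℕ) : IntegralRing p k R) • M.frob (z i))) = z j := by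
    intro z
    rw [map_sum, map_sum, Finset.sum_eq_single j]
    · rw [integral_smul_def, map_smul, frob, LinearEquiv.symm_apply_apply,
        ← ScalarExtension.tmul_eq_smul, ScalarExtension.liftAddHom_tmul]
      change slice p k R j _ • z j = _
      rw [slice_X_pow, if_pos rfl, one_smul]
    · intro i _ hij
      rw [integral_smul_def, map_smul, frob, LinearEquiv.symm_apply_apply,
        ← ScalarExtension.tmul_eq_smul, ScalarExtension.liftAddHom_tmul]
      change slice p k R j _ • z i = _
      rw [slice_X_pow, if_neg hij.symm]
      exact zero_smul (LaurentRing p k R) (z i)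
    · simp
  rw [← key x, h, key y]

/-- Power series have power series slices, so the sums on the right are stable under scalars.
Together with `sum_frob_injective` this tests membership in `Φ(φ^* L)` component by component,
although `L` need not be free. -/
theorem mem_phiImage_iff {L : Submodule (IntegralRing p k R) M.carrier} {m : M.carrier} :
    m ∈ M.phiImage L ↔ ∃ x : Fin p → M.carrier, (∀ i, x i ∈ L) ∧
      ∑ i : Fin p, (PowerSeries.X ^ (i : ℕ) : IntegralRing p k R) • M.frob (x i) = m := by
  constructor
  · intro hm
    induction hm using Submodule.span_induction with
    | mem m hm =>
      obtain ⟨n, hn, rfl⟩ := hm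
      have hp := (Fact.out : p.Prime).pos
      refine ⟨fun i => if (i : ℕ) = 0 then n else 0, fun i => ?_, ?_⟩
      · dsimp only
        split_ifs
        exacts [hn, zero_mem _]
      · rw [Finset.sum_eq_single ⟨0, hp⟩]
        · simp
        · intro i _ hi
          dsimp only
          rw [if_neg fun h => hi (Fin.ext h), frob_zero, smul_zero]
        · simp
    | zero => exact ⟨0, fun _ => zero_mem _, by simp [frob_zero]⟩
    | add a b _ _ ha hb =>
      obtain ⟨x, hx, rfl⟩ := ha
      obtain ⟨y, hy, rfl⟩ := hb
      refine ⟨x + y, fun i => add_mem (hx i) (hy i), ?_⟩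
      simp only [Pi.add_apply, frob_add, smul_add, Finset.sum_add_distrib]
    | smul s a _ ha =>
      obtain ⟨x, hx, rfl⟩ := ha
      have key : ∀ i : Fin p, ∃ z : Fin p → M.carrier, (∀ j, z j ∈ L) ∧
          ∑ j : Fin p, (PowerSeries.X ^ (j : ℕ) : IntegralRing p k R) • M.frob (z j) =
            s • (PowerSeries.X ^ (i : ℕ) : IntegralRing p k R) • M.frob (x i) := fun i => by
        obtain ⟨c, hc⟩ := exists_integral_slices (p := p) (k := k) (R := R)
          (s * PowerSeries.X ^ (i : ℕ))
        refine ⟨fun j => c j • x i, fun j => L.smul_mem _ (hx i), ?_⟩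
        rw [smul_smul, integral_smul_def, ← hc, Finset.sum_smul]
        refine Finset.sum_congr rfl fun j _ => ?_
        dsimp only
        rw [integral_smul_def, integral_smul_def, frob_smul, smul_smul]
      choose z hz hz' using key
      refine ⟨fun j => ∑ i, z i j, fun j => sum_mem fun i _ => hz i j, ?_⟩
      simp only [frob_sum, Finset.smul_sum]
      rw [Finset.sum_comm]
      exact Finset.sum_congr rfl fun i _ => hz' i
  · rintro ⟨x, hx, rfl⟩
    exact sum_mem fun i _ => Submodule.smul_mem _ _ (Submodule.subset_span ⟨x i, hx i, rfl⟩)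

end Finite

theorem phiImage_mono {L L' : Submodule (IntegralRing p k R) M.carrier} (h : L ≤ L') :
    M.phiImage L ≤ M.phiImage L' :=
  Submodule.span_mono (Set.image_mono h)

theorem frob_mem_phiImage {L : Submodule (IntegralRing p k R) M.carrier} {m : M.carrier}
    (hm : m ∈ L) : M.frob m ∈ M.phiImage L :=
  Submodule.subset_span ⟨m, hm, rfl⟩

/-- As `u` acts bijectively on `M` and `L` is a submodule, the only content of `L[1/u] = M` is that
every element of `M` is carried into `L` by a power of `u`. -/
theorem isLocalizedModule_subtype_iff (L : Submodule (IntegralRing p k R) M.carrier) :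
    IsLocalizedModule (Submonoid.powers (PowerSeries.X : IntegralRing p k R)) L.subtype ↔
      ∀ m : M.carrier, ∃ N : ℕ, (PowerSeries.X ^ N : IntegralRing p k R) • m ∈ L := by
  constructor
  · intro h m
    obtain ⟨⟨x, ⟨_, N, rfl⟩⟩, hx⟩ := h.surj m
    exact ⟨N, hx ▸ x.2⟩
  · intro h
    refine ⟨?_, fun m => ?_, fun {x y} hxy => ⟨1, ?_⟩⟩
    · rintro ⟨_, N, rfl⟩
      rw [Module.End.isUnit_iff]
      exact ⟨fun m m' hm => M.X_pow_smul_injective N hm, fun m => M.exists_X_pow_smul_eq N m⟩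
    · obtain ⟨N, hN⟩ := h m
      exact ⟨⟨⟨_, hN⟩, ⟨_, N, rfl⟩⟩, rfl⟩
    · rw [Subtype.ext hxy]

/-! ### Comparison of lattices of bounded height and the largest one -/

section Lattice

variable {M} {e : ℕ} {L L' : Submodule (IntegralRing p k R) M.carrier}

theorem IsLatticeOfHeightLEOne.exists_X_pow_smul_mem (h : M.IsLatticeOfHeightLEOne e L)
    (m : M.carrier) : ∃ N : ℕ, (PowerSeries.X ^ N : IntegralRing p k R) • m ∈ L :=
  (M.isLocalizedModule_subtype_iff L).1 h.localization m

theorem IsLatticeOfHeightLEOne.frob_mem (h : M.IsLatticeOfHeightLEOne e L) {m : M.carrier}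
    (hm : m ∈ L) : M.frob m ∈ L :=
  h.phiImage_le (M.frob_mem_phiImage hm)

theorem X_pow_smul_mem_of_le {N N' : ℕ} (hN : N ≤ N') {m : M.carrier}
    (h : (PowerSeries.X ^ N : IntegralRing p k R) • m ∈ L) :
    (PowerSeries.X ^ N' : IntegralRing p k R) • m ∈ L := by
  rw [← Nat.sub_add_cancel hN, pow_add, mul_smul]
  exact L.smul_mem _ h

/-- A finitely generated submodule is contained in `u ^ (-N) L` for some `N`. -/
theorem exists_X_pow_smul_mem_of_fg
    (hL : ∀ m : M.carrier, ∃ N : ℕ, (PowerSeries.X ^ N : IntegralRing p k R) • m ∈ L)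
    (hL' : L'.FG) : ∃ N : ℕ, ∀ m ∈ L', (PowerSeries.X ^ N : IntegralRing p k R) • m ∈ L := by
  obtain ⟨s, rfl⟩ := hL'
  choose N hN using hL
  refine ⟨s.sup N, fun m hm => ?_⟩
  have : Submodule.span (IntegralRing p k R) (s : Set M.carrier) ≤
      L.comap (DistribSMul.toLinearMap (IntegralRing p k R) M.carrier
        (PowerSeries.X ^ s.sup N : IntegralRing p k R)) :=
    Submodule.span_le.2 fun m hm => X_pow_smul_mem_of_le (Finset.le_sup (f := N) hm) (hN m)
  exact this hm

/-- Any two submodules of height at most `e` differ by at most `u ^ e`. -/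
theorem IsLatticeOfHeightLEOne.X_pow_smul_mem [Finite k] (h : M.IsLatticeOfHeightLEOne e L)
    (h' : M.IsLatticeOfHeightLEOne e L') {m : M.carrier} (hm : m ∈ L') :
    (PowerSeries.X ^ e : IntegralRing p k R) • m ∈ L := by
  have hp := (Fact.out : p.Prime).two_le
  -- Write `e + i = p q + r` with `r < p`. For `m ∈ L'` the element `u^(e+i) Φ(1 ⊗ m) = u^r Φ(1 ⊗
  -- u^q m)` lies in `Φ(φ^* L)`, and uniqueness of components gives `u^q m ∈ L`.
  have step : ∀ i : ℕ, (∀ m ∈ L', (PowerSeries.X ^ i : IntegralRing p k R) • m ∈ L) →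
      ∀ m ∈ L', (PowerSeries.X ^ ((e + i) / p) : IntegralRing p k R) • m ∈ L := by
    intro i hi m hm
    have h1 := h.pow_smul_mem _ (hi _ (h'.frob_mem hm))
    rw [smul_smul, ← pow_add, mem_phiImage_iff] at h1
    obtain ⟨x, hx, hxm⟩ := h1
    have hlt := Nat.mod_lt (e + i) (by omega : 0 < p)
    have h2 : x = fun j : Fin p => if (j : ℕ) = (e + i) % p then
        (PowerSeries.X ^ ((e + i) / p) : IntegralRing p k R) • m else 0 := by
      refine sum_frob_injective (hxm.trans ?_)
      rw [Finset.sum_eq_single ⟨(e + i) % p, hlt⟩]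
      · rw [if_pos rfl, frob_X_pow_smul, smul_smul, ← pow_add]
        exact congrArg (fun t => (PowerSeries.X ^ t : IntegralRing p k R) • M.frob m)
          (Nat.mod_add_div _ _).symm
      · intro j _ hj
        rw [if_neg fun h => hj (Fin.ext h), frob_zero, smul_zero]
      · simp
    have h3 := hx ⟨(e + i) % p, hlt⟩
    rw [h2] at h3
    simpa using h3
  have main : ∀ i : ℕ, (∀ m ∈ L', (PowerSeries.X ^ i : IntegralRing p k R) • m ∈ L) →
      ∀ m ∈ L', (PowerSeries.X ^ e : IntegralRing p k R) • m ∈ L := by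
    intro i
    induction i using Nat.strong_induction_on with
    | _ i ih =>
      intro hi
      rcases le_or_gt i e with hie | hie
      · exact fun m hm => X_pow_smul_mem_of_le hie (hi m hm)
      -- For `i > e` the exponent strictly drops, since `e + i < 2 i ≤ p i`.
      · refine ih _ ?_ (step i hi)
        rw [Nat.div_lt_iff_lt_mul (by omega)]
        nlinarith
  obtain ⟨i, hi⟩ := exists_X_pow_smul_mem_of_fg h.exists_X_pow_smul_mem h'.fg
  exact main i hi m hm

/-- Multiplication by `u^N` embeds `L'` into the Noetherian module `L`. -/
theorem fg_of_X_pow_smul_mem [IsNoetherianRing (CoeffRing p k R)] (hL : L.FG) {N : ℕ}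
    (h : ∀ m ∈ L', (PowerSeries.X ^ N : IntegralRing p k R) • m ∈ L) : L'.FG := by
  have : IsNoetherian (IntegralRing p k R) L := isNoetherian_of_fg_of_noetherian L hL
  let f : L' →ₗ[IntegralRing p k R] L :=
    ((DistribSMul.toLinearMap (IntegralRing p k R) M.carrier
      (PowerSeries.X ^ N : IntegralRing p k R)).comp L'.subtype).codRestrict L
        fun m => h m m.2
  have hf : Function.Injective f := fun a b hab =>
    Subtype.ext (M.X_pow_smul_injective N (congrArg Subtype.val hab))
  have := isNoetherian_of_injective f hf
  exact Module.Finite.iff_fg.1 inferInstance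

variable (M e) in
/-- The largest submodule of height at most `e`. -/
def maxLattice : Submodule (IntegralRing p k R) M.carrier :=
  sSup {L | M.IsLatticeOfHeightLEOne e L}

theorem IsLatticeOfHeightLEOne.le_maxLattice (h : M.IsLatticeOfHeightLEOne e L) :
    L ≤ M.maxLattice e :=
  le_sSup h

theorem IsLatticeOfHeightLEOne.isLattice_maxLattice [Finite k]
    [IsNoetherianRing (CoeffRing p k R)] (h : M.IsLatticeOfHeightLEOne e L) :
    M.IsLatticeOfHeightLEOne e (M.maxLattice e) where
  fg := by
    refine fg_of_X_pow_smul_mem h.fg (N := e) ?_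
    have : M.maxLattice e ≤ L.comap (DistribSMul.toLinearMap (IntegralRing p k R) M.carrier
        (PowerSeries.X ^ e : IntegralRing p k R)) :=
      sSup_le fun L' hL' m hm => h.X_pow_smul_mem hL' hm
    exact fun m hm => this hm
  localization := by
    refine (M.isLocalizedModule_subtype_iff _).2 fun m => ?_
    obtain ⟨N, hN⟩ := h.exists_X_pow_smul_mem m
    exact ⟨N, h.le_maxLattice hN⟩
  pow_smul_mem := by
    have : M.maxLattice e ≤ (M.phiImage (M.maxLattice e)).comap
        (DistribSMul.toLinearMap (IntegralRing p k R) M.carrier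
          (PowerSeries.X ^ e : IntegralRing p k R)) :=
      sSup_le fun L' hL' m hm =>
        M.phiImage_mono (IsLatticeOfHeightLEOne.le_maxLattice hL') (hL'.pow_smul_mem m hm)
    exact fun m hm => this hm
  phiImage_le := by
    refine Submodule.span_le.2 ?_
    rintro _ ⟨m, hm, rfl⟩
    have : ∀ m ∈ M.maxLattice e, M.frob m ∈ M.maxLattice e := by
      intro m hm
      rw [maxLattice, sSup_eq_iSup'] at hm
      induction hm using Submodule.iSup_induction' with
      | mem L' m hm => exact IsLatticeOfHeightLEOne.le_maxLattice L'.2 (L'.2.frob_mem hm)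
      | zero => rw [frob_zero]; exact zero_mem _
      | add a b _ _ ha hb => rw [frob_add]; exact add_mem ha hb
    exact this m hm

end Lattice

end PhiModule

/-! ### Base change of the coefficient rings -/

section BaseChange

variable {p : ℕ} [Fact p.Prime] (k : Type u) [Field k] [Algebra (ZMod p) k]
  {R S : Type u} [CommRing R] [Algebra (ZMod p) R] [CommRing S] [Algebra (ZMod p) S]

/-- The homomorphism `R ⊗ k → S ⊗ k` induced by `R → S`. -/
def coeffBaseChange (f : R →ₐ[ZMod p] S) : CoeffRing p k R →+* CoeffRing p k S :=
  (Algebra.TensorProduct.map f (AlgHom.id (ZMod p) k)).toRingHom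

theorem coeffBaseChange_tmul (f : R →ₐ[ZMod p] S) (r : R) (a : k) :
    coeffBaseChange k f (r ⊗ₜ a) = f r ⊗ₜ a := rfl

theorem laurentBaseChange_eq (f : R →ₐ[ZMod p] S) :
    laurentBaseChange p k f = laurentMap (coeffBaseChange k f) := rfl

theorem coeffBaseChange_surjective {f : R →ₐ[ZMod p] S} (hf : Function.Surjective f) :
    Function.Surjective (coeffBaseChange k f) :=
  LinearMap.rTensor_surjective k (g := f.toLinearMap) hf

theorem coeffBaseChange_injective {f : R →ₐ[ZMod p] S} (hf : Function.Injective f) :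
    Function.Injective (coeffBaseChange k f) :=
  Module.Flat.rTensor_preserves_injective_linearMap (M := k) f.toLinearMap hf

theorem coeffBaseChange_coeffFrobenius (f : R →ₐ[ZMod p] S) (x : CoeffRing p k R) :
    coeffBaseChange k f (coeffFrobenius p k R x) =
      coeffFrobenius p k S (coeffBaseChange k f x) := by
  induction x using TensorProduct.induction_on with
  | zero => simp only [map_zero]
  | tmul r a => rfl
  | add x y hx hy => simp only [map_add, hx, hy]

theorem laurentBaseChange_phi (f : R →ₐ[ZMod p] S) (x : LaurentRing p k R) :
    laurentBaseChange p k f (phi p k R x) = phi p k S (laurentBaseChange p k f x) := by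
  ext n
  rw [laurentBaseChange_eq, laurentMap_coeff]
  by_cases hn : (p : ℤ) ∣ n
  · obtain ⟨m, rfl⟩ := hn
    rw [phi_coeff_mul, phi_coeff_mul, laurentMap_coeff, coeffBaseChange_coeffFrobenius]
  · rw [phi_coeff_of_not_dvd _ _ _ _ hn, phi_coeff_of_not_dvd _ _ _ _ hn, map_zero]

/-- The homomorphism `(R ⊗ k)[[u]] → (S ⊗ k)[[u]]` induced by `R → S`. -/
abbrev integralBaseChange (f : R →ₐ[ZMod p] S) : IntegralRing p k R →+* IntegralRing p k S :=
  PowerSeries.map (coeffBaseChange k f)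

theorem laurentBaseChange_algebraMap (f : R →ₐ[ZMod p] S) (s : IntegralRing p k R) :
    laurentBaseChange p k f (algebraMap _ _ s) =
      algebraMap (IntegralRing p k S) (LaurentRing p k S) (integralBaseChange k f s) :=
  laurentMap_algebraMap _ s

theorem integralBaseChange_surjective {f : R →ₐ[ZMod p] S} (hf : Function.Surjective f) :
    Function.Surjective (integralBaseChange k f) :=
  PowerSeries.map_surjective _ (coeffBaseChange_surjective k hf)

/-- An element of `R` as an element of `(R ⊗ k)[[u]]`. -/
def integralScalar (p : ℕ) [Fact p.Prime] [Algebra (ZMod p) k] [Algebra (ZMod p) R] (r : R) :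
    IntegralRing p k R :=
  PowerSeries.C (r ⊗ₜ[ZMod p] (1 : k))

theorem integralScalar_mul (r s : R) :
    integralScalar k p (r * s) = integralScalar k p r * integralScalar k p s := by
  rw [integralScalar, integralScalar, integralScalar, ← map_mul,
    Algebra.TensorProduct.tmul_mul_tmul, one_mul]

theorem integralBaseChange_integralScalar (f : R →ₐ[ZMod p] S) (r : R) :
    integralBaseChange k f (integralScalar k p r) = integralScalar k p (f r) := by
  rw [integralScalar, PowerSeries.map_C, coeffBaseChange_tmul, integralScalar]

end BaseChange

/-! ### Reduction of `φ`-modules and of their lattices along a surjection -/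

namespace PhiModule

variable {p : ℕ} [Fact p.Prime] {k : Type u} [Field k] [Algebra (ZMod p) k] {d : ℕ}
  {R S : Type u} [CommRing R] [Algebra (ZMod p) R] [CommRing S] [Algebra (ZMod p) S]

theorem frob_integralScalar_smul (M : PhiModule p k d R) (r : R) (m : M.carrier) :
    M.frob (integralScalar k p r • m) = integralScalar k p r • M.frob m := by
  rw [integral_smul_def, frob_smul, integralScalar, algebraMap_C, phi_C_tmul_one,
    integral_smul_def, algebraMap_C]

namespace BaseChangeIso

variable {f : R →ₐ[ZMod p] S} {M : PhiModule p k d R} {N : PhiModule p k d S}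
  (g : BaseChangeIso f M N)

theorem red_add (m m' : M.carrier) : g.red (m + m') = g.red m + g.red m' := by
  rw [red, ScalarExtension.tmul_add, map_add]; rfl

theorem red_zero : g.red 0 = 0 :=
  map_zero (AddMonoidHom.mk' g.red g.red_add)

theorem red_sum {ι : Type*} (s : Finset ι) (m : ι → M.carrier) :
    g.red (∑ i ∈ s, m i) = ∑ i ∈ s, g.red (m i) :=
  map_sum (AddMonoidHom.mk' g.red g.red_add) m s

theorem red_sub (m m' : M.carrier) : g.red (m - m') = g.red m - g.red m' :=
  map_sub (AddMonoidHom.mk' g.red g.red_add) m m'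

theorem red_smul (b : LaurentRing p k R) (m : M.carrier) :
    g.red (b • m) = laurentBaseChange p k f b • g.red m := by
  rw [red, ScalarExtension.tmul_smul, one_mul, ScalarExtension.tmul_eq_smul, map_smul]; rfl

theorem red_integral_smul (s : IntegralRing p k R) (m : M.carrier) :
    g.red (s • m) = integralBaseChange k f s • g.red m := by
  rw [integral_smul_def, red_smul, laurentBaseChange_algebraMap, integral_smul_def]

theorem red_X_pow_smul (n : ℕ) (m : M.carrier) :
    g.red ((PowerSeries.X ^ n : IntegralRing p k R) • m) =
      (PowerSeries.X ^ n : IntegralRing p k S) • g.red m := by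
  rw [red_integral_smul, map_pow, PowerSeries.map_X]

theorem red_frob (m : M.carrier) : g.red (M.frob m) = N.frob (g.red m) := g.comm m

theorem red_surjective (hf : Function.Surjective f) : Function.Surjective g.red := fun y => by
  obtain ⟨m, hm⟩ := ScalarExtension.exists_eq_tmul_one (f := laurentBaseChange p k f)
    (laurentMap_surjective (coeffBaseChange_surjective k hf)) (g.iso.symm y)
  exact ⟨m, (congrArg g.iso hm).trans (g.iso.apply_symm_apply y)⟩

theorem exists_eq_smul_of_red_eq_zero (hf : Function.Surjective f) {r : R}
    (hr : ∀ a, coeffBaseChange k f a = 0 → ∃ b, a = (r ⊗ₜ 1) * b) {m : M.carrier}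
    (hm : g.red m = 0) : ∃ m', m = integralScalar k p r • m' := by
  have h : ScalarExtension.tmul (laurentBaseChange p k f) 1 m = 0 :=
    g.iso.injective (hm.trans (map_zero _).symm)
  have := ScalarExtension.mem_of_tmul_one_eq_zero
    (laurentMap_surjective (coeffBaseChange_surjective k hf)) h
    (LinearMap.range (DistribSMul.toLinearMap (LaurentRing p k R) M.carrier
      (algebraMap _ (LaurentRing p k R) (integralScalar k p r)))) (fun a ha m => by
        obtain ⟨b, rfl⟩ := exists_eq_C_mul_of_laurentMap_eq_zero hr ha
        rw [mul_smul]
        exact ⟨b • m, by rw [integralScalar, algebraMap_C]; rfl⟩)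
  obtain ⟨m', hm'⟩ := this
  exact ⟨m', hm'.symm⟩

/-- The image of a submodule under reduction along a surjective homomorphism. -/
def redImage (hf : Function.Surjective f) (L : Submodule (IntegralRing p k R) M.carrier) :
    Submodule (IntegralRing p k S) N.carrier where
  carrier := g.red '' L
  add_mem' := by
    rintro _ _ ⟨a, ha, rfl⟩ ⟨b, hb, rfl⟩
    exact ⟨a + b, add_mem ha hb, g.red_add a b⟩
  zero_mem' := ⟨0, zero_mem _, g.red_zero⟩
  smul_mem' := by
    rintro s _ ⟨a, ha, rfl⟩
    obtain ⟨t, rfl⟩ := integralBaseChange_surjective k hf s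
    exact ⟨t • a, L.smul_mem t ha, g.red_integral_smul t a⟩

variable {hf : Function.Surjective f} {L : Submodule (IntegralRing p k R) M.carrier}

theorem redImage_mono {L' : Submodule (IntegralRing p k R) M.carrier} (h : L ≤ L') :
    g.redImage hf L ≤ g.redImage hf L' :=
  Set.image_mono h

theorem redImage_fg (hL : L.FG) : (g.redImage hf L).FG := by
  classical
  obtain ⟨s, rfl⟩ := hL
  refine ⟨s.image g.red, le_antisymm (Submodule.span_le.2 ?_) ?_⟩
  · rw [Finset.coe_image]
    exact Set.image_mono Submodule.subset_span
  · rintro _ ⟨m, hm, rfl⟩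
    rw [SetLike.mem_coe] at hm
    induction hm using Submodule.span_induction with
    | mem m hm => exact Submodule.subset_span (by simpa using ⟨m, hm, rfl⟩)
    | zero => rw [red_zero]; exact zero_mem _
    | add a b _ _ ha hb => rw [red_add]; exact add_mem ha hb
    | smul s a _ ha => rw [red_integral_smul]; exact Submodule.smul_mem _ _ ha

theorem red_mem_phiImage {m : M.carrier} (hm : m ∈ M.phiImage L) :
    g.red m ∈ N.phiImage (g.redImage hf L) := by
  induction hm using Submodule.span_induction with
  | mem m hm =>
    obtain ⟨a, ha, rfl⟩ := hm
    rw [red_frob]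
    exact N.frob_mem_phiImage ⟨a, ha, rfl⟩
  | zero => rw [red_zero]; exact zero_mem _
  | add a b _ _ ha hb => rw [red_add]; exact add_mem ha hb
  | smul s a _ ha => rw [red_integral_smul]; exact Submodule.smul_mem _ _ ha

variable (hf) in
theorem isLattice_redImage {e : ℕ} (h : M.IsLatticeOfHeightLEOne e L) :
    N.IsLatticeOfHeightLEOne e (g.redImage hf L) where
  fg := g.redImage_fg h.fg
  localization := by
    refine (N.isLocalizedModule_subtype_iff _).2 fun y => ?_
    obtain ⟨m, rfl⟩ := g.red_surjective hf y
    obtain ⟨n, hn⟩ := h.exists_X_pow_smul_mem m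
    exact ⟨n, _, hn, g.red_X_pow_smul n m⟩
  pow_smul_mem := by
    rintro _ ⟨m, hm, rfl⟩
    rw [← red_X_pow_smul]
    exact g.red_mem_phiImage (h.pow_smul_mem m hm)
  phiImage_le := by
    refine Submodule.span_le.2 ?_
    rintro _ ⟨_, ⟨m, hm, rfl⟩, rfl⟩
    exact ⟨_, h.frob_mem hm, g.red_frob m⟩

/-- The submodule of all reductions of `y` with `r y ∈ L`. -/
def divImage (hf : Function.Surjective f) (r : R)
    (L : Submodule (IntegralRing p k R) M.carrier) : Submodule (IntegralRing p k S) N.carrier :=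
  g.redImage hf (L.comap (DistribSMul.toLinearMap _ _ (integralScalar k p r)))

-- This produces new lattices in `N` from a lattice in `M`. The hypothesis `hr` says that dividing
-- by `r` is unambiguous after reduction, which gives finite generation from that of `L ∩ r M`. The
-- height conditions survive because Frobenius commutes with the scalar `r`.
variable (hf) in
theorem isLattice_divImage [Finite k] [IsNoetherianRing (CoeffRing p k R)] {e : ℕ} {r : R}
    (hr : ∀ m : M.carrier, integralScalar k p r • m = 0 → g.red m = 0)
    (h : M.IsLatticeOfHeightLEOne e L) :
    N.IsLatticeOfHeightLEOne e (g.divImage hf r L) where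
  fg := by
    classical
    let D := DistribSMul.toLinearMap (IntegralRing p k R) M.carrier (integralScalar k p r)
    have : IsNoetherian (IntegralRing p k R) L := isNoetherian_of_fg_of_noetherian L h.fg
    have h1 : ((L.comap D).map D).FG := by
      rw [Submodule.map_comap_eq]
      exact Submodule.FG.of_le_of_isNoetherian inf_le_right
    obtain ⟨t, ht⟩ := h1
    have h2 : (t : Set M.carrier) ⊆ D '' (L.comap D) := by
      intro x hx
      have : x ∈ (L.comap D).map D := ht ▸ Submodule.subset_span hx
      exact this
    obtain ⟨t', ht', rfl⟩ := Finset.subset_set_image_iff.1 h2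
    have h3 : g.divImage hf r L = g.redImage hf (Submodule.span _ (t' : Set M.carrier)) := by
      refine le_antisymm ?_ (g.redImage_mono (Submodule.span_le.2 ht'))
      rintro _ ⟨m, hm, rfl⟩
      have h4 : D m ∈ (Submodule.span _ (t' : Set M.carrier)).map D := by
        rw [Submodule.map_span, ← Finset.coe_image, ht]
        exact ⟨m, hm, rfl⟩
      obtain ⟨m', hm', hD⟩ := h4
      refine ⟨m', hm', ?_⟩
      rw [← sub_eq_zero, ← red_sub]
      refine hr _ ?_
      rw [smul_sub, sub_eq_zero]
      exact hD
    rw [h3]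
    exact g.redImage_fg ⟨t', rfl⟩
  localization := by
    refine (N.isLocalizedModule_subtype_iff _).2 fun y => ?_
    obtain ⟨m, rfl⟩ := g.red_surjective hf y
    obtain ⟨n, hn⟩ := h.exists_X_pow_smul_mem (integralScalar k p r • m)
    exact ⟨n, _, by rwa [SetLike.mem_coe, Submodule.mem_comap, DistribSMul.toLinearMap_apply,
      smul_comm], g.red_X_pow_smul n m⟩
  pow_smul_mem := by
    rintro _ ⟨m, hm, rfl⟩
    have h1 := h.pow_smul_mem _ hm
    rw [mem_phiImage_iff] at h1
    obtain ⟨x, hx, hxm⟩ := h1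
    obtain ⟨y, hy⟩ := M.exists_sum_frob ((PowerSeries.X ^ e : IntegralRing p k R) • m)
    -- By uniqueness, the components of `r u^e m` are `r` times those of `u^e m`; hence the latter
    -- belong to the preimage of `L` under `r`.
    have h2 : x = fun i => integralScalar k p r • y i := by
      refine sum_frob_injective (hxm.trans ?_)
      rw [DistribSMul.toLinearMap_apply, smul_comm, ← hy, Finset.smul_sum]
      refine Finset.sum_congr rfl fun i _ => ?_
      rw [frob_integralScalar_smul, smul_comm]
    rw [← red_X_pow_smul, ← hy]
    refine g.red_mem_phiImage ((M.mem_phiImage_iff).2 ⟨y, fun i => ?_, rfl⟩)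
    have := hx i
    rwa [h2] at this
  phiImage_le := by
    refine Submodule.span_le.2 ?_
    rintro _ ⟨_, ⟨m, hm, rfl⟩, rfl⟩
    refine ⟨M.frob m, ?_, g.red_frob m⟩
    rw [SetLike.mem_coe, Submodule.mem_comap, DistribSMul.toLinearMap_apply,
      ← frob_integralScalar_smul]
    exact h.frob_mem hm

end BaseChangeIso
end PhiModule

/-! ### Generators of lattices over finite products of fields -/

theorem finrank_eq_of_isBaseChange {S T B B' K : Type u} [CommRing S] [CommRing T] [CommRing B]
    [CommRing B'] [Field K] [Algebra S T] [Algebra S B] [Algebra B B'] [Algebra B' K]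
    [Algebra S K] [Algebra B K] [Algebra T K] [IsScalarTower S B K] [IsScalarTower B B' K]
    [IsScalarTower S T K] {L M N : Type u} [AddCommGroup L] [Module S L] [AddCommGroup M]
    [Module S M] [Module B M] [IsScalarTower S B M] [AddCommGroup N] [Module S N] [Module T N]
    [IsScalarTower S T N] [Module.Free T N] [Nontrivial T] {j : L →ₗ[S] M} (hj : IsBaseChange B j)
    {d : ℕ} (e : B' ⊗[B] M ≃ₗ[B'] (Fin d → B')) {n : L →ₗ[S] N} (hn : IsBaseChange T n) :
    Module.finrank T N = d := by
  let f₁ : M →ₗ[B] (Fin d → B') := (e.restrictScalars B).toLinearMap.comp (TensorProduct.mk B B' M 1)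
  have h₁ : IsBaseChange B' f₁ := IsBaseChange.of_equiv e fun _ => rfl
  let f₂ : (Fin d → B') →ₗ[B'] (Fin d → K) := (Algebra.linearMap B' K).compLeft (Fin d)
  have h₂ : IsBaseChange K f₂ := by
    refine IsBaseChange.of_equiv (TensorProduct.piScalarRight B' K K (Fin d)) fun x => ?_
    ext i
    simp [f₂, Algebra.smul_def]
  have h₃ := h₁.comp h₂
  have h₄ := hj.comp h₃
  -- The base change of `L` to `K` through `B` and `B'` is `K^d`. It also factors through `T`, so
  -- `N` becomes `K^d` over `K`, and the rank of the free module `N` is `d`.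
  let g : N →ₗ[T] (Fin d → K) := hn.lift
    (((f₂.restrictScalars B).comp f₁).restrictScalars S ∘ₗ j)
  have hg : IsBaseChange K g := by
    refine IsBaseChange.of_comp hn ?_
    rw [IsBaseChange.lift_comp]
    exact h₄
  have := hg.equiv.finrank_eq
  rwa [Module.finrank_baseChange, Module.finrank_fin_fun] at this

theorem PowerSeries.isTorsionFree_of_X_smul {κ N : Type*} [Field κ] [AddCommGroup N]
    [Module (PowerSeries κ) N]
    (h : ∀ x : N, (PowerSeries.X : PowerSeries κ) • x = 0 → x = 0) :
    Module.IsTorsionFree (PowerSeries κ) N := by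
  refine Module.IsTorsionFree.of_smul_eq_zero fun t x htx => ?_
  by_contra! hne
  obtain ⟨n, v, rfl⟩ := IsDiscreteValuationRing.eq_unit_mul_pow_irreducible hne.1
    (PowerSeries.X_prime (R := κ)).irreducible
  rw [mul_smul] at htx
  have h1 := (IsUnit.smul_eq_zero v.isUnit).1 htx
  have h2 : ∀ n : ℕ, ∀ x : N, (PowerSeries.X ^ n : PowerSeries κ) • x = 0 → x = 0 := by
    intro n
    induction n with
    | zero => intro x hx; simpa using hx
    | succ n ih =>
      intro x hx
      rw [pow_succ, mul_smul] at hx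
      exact h x (ih _ hx)
  exact hne.2 (h2 n x h1)

section Rank

variable {A : Type u} [CommRing A] {B' : Type u} [CommRing B'] {θ : LaurentSeries A →+* B'}
  {L M : Type u} [AddCommGroup L] [Module (PowerSeries A) L] [AddCommGroup M]
  [Module (PowerSeries A) M] [Module (LaurentSeries A) M]
  [IsScalarTower (PowerSeries A) (LaurentSeries A) M]
  {j : L →ₗ[PowerSeries A] M} {d : ℕ}

/-- The component at a maximal ideal `I` generated by an idempotent `1 - ε` of a lattice in a
module that becomes free of rank `d`. -/
theorem exists_generators_of_idempotent [Module.Finite (PowerSeries A) L]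
    (hX : ∀ x : L, (PowerSeries.X : PowerSeries A) • x = 0 → x = 0)
    [hj : IsLocalizedModule (Submonoid.powers (PowerSeries.X : PowerSeries A)) j]
    (e : ScalarExtension θ M ≃ₗ[B'] (Fin d → B'))
    (I : Ideal A) [I.IsMaximal] {ε : A} (hεI : 1 - ε ∈ I) (hε : ∀ a ∈ I, ε * a = 0)
    (hθ : θ (HahnSeries.C ε) ≠ 0) :
    ∃ w : Fin d → L, ∀ x : L, ∃ s : Fin d → PowerSeries A,
      (PowerSeries.C ε : PowerSeries A) • x =
        ∑ i, s i • (PowerSeries.C ε : PowerSeries A) • w i := by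
  let : Field (A ⧸ I) := Ideal.Quotient.field I
  let q : PowerSeries A →+* PowerSeries (A ⧸ I) := PowerSeries.map (Ideal.Quotient.mk I)
  have hq : Function.Surjective q := PowerSeries.map_surjective _ Ideal.Quotient.mk_surjective
  have hqker : ∀ s, q s = 0 → PowerSeries.C ε * s = 0 := fun s hs => by
    ext n
    rw [PowerSeries.coeff_C_mul, map_zero]
    refine hε _ ?_
    have := congrArg (PowerSeries.coeff n) hs
    rwa [PowerSeries.coeff_map, map_zero, Ideal.Quotient.eq_zero_iff_mem] at this
  have hqε : q (PowerSeries.C ε) = 1 := by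
    rw [PowerSeries.map_C, ← map_one PowerSeries.C, ← map_one (Ideal.Quotient.mk I)]
    exact congrArg _ (Ideal.Quotient.eq.2 (by simpa using I.neg_mem hεI))
  -- the quotient `N` of `L`
  let N := ScalarExtension q L
  have hzero : ∀ x : L, ScalarExtension.tmul q 1 x = 0 → (PowerSeries.C ε : PowerSeries A) • x = 0 :=
    fun x hx => by
      refine (LinearMap.mem_ker (f := DistribSMul.toLinearMap (PowerSeries A) L
        (PowerSeries.C ε : PowerSeries A))).1 ?_
      refine ScalarExtension.mem_of_tmul_one_eq_zero hq hx _ fun a ha m => ?_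
      rw [LinearMap.mem_ker, DistribSMul.toLinearMap_apply, smul_smul, hqker a ha, zero_smul]
  have hεtmul : ∀ x : L, ScalarExtension.tmul q 1 ((PowerSeries.C ε : PowerSeries A) • x) =
      ScalarExtension.tmul q 1 x := fun x => by
    rw [ScalarExtension.tmul_smul, hqε, one_mul]
  -- If `u x` vanishes in `N`, then `u ε x = 0` in `L`, so `ε x = 0`; but `x` and `ε x` have the
  -- same class in `N`. Torsion-free and finite over a discrete valuation ring, `N` is free.
  have htf : Module.IsTorsionFree (PowerSeries (A ⧸ I)) N := by
    refine PowerSeries.isTorsionFree_of_X_smul fun y hy => ?_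
    obtain ⟨x, rfl⟩ := ScalarExtension.exists_eq_tmul_one hq y
    have h1 : ScalarExtension.tmul q 1 ((PowerSeries.X : PowerSeries A) • x) = 0 := by
      rw [ScalarExtension.tmul_smul, ScalarExtension.tmul_eq_smul, one_mul, PowerSeries.map_X]
      exact hy
    have h2 := hzero _ h1
    rw [smul_comm] at h2
    rw [← hεtmul, hX _ h2]
    exact map_zero (AddMonoidHom.mk' (ScalarExtension.tmul q 1) (ScalarExtension.tmul_add q 1))
  let : Algebra (PowerSeries A) (PowerSeries (A ⧸ I)) := q.toAlgebra
  have hfin : Module.Finite (PowerSeries (A ⧸ I)) N :=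
    (inferInstance : Module.Finite _ (PowerSeries (A ⧸ I) ⊗[PowerSeries A] L))
  have hfree : Module.Free (PowerSeries (A ⧸ I)) N := Module.free_of_finite_type_torsion_free'
  -- a point of the component
  obtain ⟨J, hJ, hεJ⟩ : ∃ J : Ideal B', J.IsMaximal ∧ θ (HahnSeries.C (1 - ε)) ∈ J := by
    refine exists_max_ideal_of_mem_nonunits fun hu => hθ ?_
    have : θ (HahnSeries.C (1 - ε)) * θ (HahnSeries.C ε) = 0 := by
      rw [← map_mul, ← map_mul, mul_comm, hε _ hεI, map_zero, map_zero]
    exact hu.mul_right_eq_zero.1 this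
  obtain ⟨K, _, π, hπ⟩ : ∃ (K : Type u) (_ : Field K) (π : B' →+* K),
      π (θ (HahnSeries.C (1 - ε))) = 0 :=
    ⟨B' ⧸ J, Ideal.Quotient.field J, Ideal.Quotient.mk J, Ideal.Quotient.eq_zero_iff_mem.2 hεJ⟩
  let : Algebra (LaurentSeries A) B' := θ.toAlgebra
  let : Algebra B' K := π.toAlgebra
  let ψ : LaurentSeries A →+* K := π.comp θ
  let : Algebra (LaurentSeries A) K := ψ.toAlgebra
  let χ : PowerSeries A →+* K := ψ.comp (algebraMap _ _)
  let : Algebra (PowerSeries A) K := χ.toAlgebra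
  have hχε : χ (PowerSeries.C ε) = 1 := by
    have h1 : χ (PowerSeries.C (1 - ε)) = 0 := by
      change ψ (algebraMap _ _ _) = 0
      rw [algebraMap_C]
      exact hπ
    rw [map_sub, map_sub, map_one, map_one, sub_eq_zero] at h1
    exact h1.symm
  -- `χ` sends `ε` to `1` while `ε` annihilates the kernel of `q`, so `χ` factors through `(A ⧸
  -- I)[[u]]`. This field `K` is where the rank `d` can be compared with that of `N`.
  have hker : RingHom.ker q ≤ RingHom.ker χ := fun s hs => by
    have := congrArg χ (hqker s hs)
    rwa [map_mul, hχε, one_mul, map_zero] at this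
  let ω : PowerSeries (A ⧸ I) →+* K := q.liftOfSurjective hq ⟨χ, hker⟩
  have hω : ∀ s, ω (q s) = χ s := RingHom.liftOfSurjective_comp_apply q hq ⟨χ, hker⟩
  let : Algebra (PowerSeries (A ⧸ I)) K := ω.toAlgebra
  have : IsScalarTower (PowerSeries A) (LaurentSeries A) K :=
    IsScalarTower.of_algebraMap_eq fun _ => rfl
  have : IsScalarTower (LaurentSeries A) B' K := IsScalarTower.of_algebraMap_eq fun _ => rfl
  have : IsScalarTower (PowerSeries A) (PowerSeries (A ⧸ I)) K :=
    IsScalarTower.of_algebraMap_eq fun s => (hω s).symm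
  have hjB : IsBaseChange (LaurentSeries A) j :=
    (isLocalizedModule_iff_isBaseChange (Submonoid.powers (PowerSeries.X : PowerSeries A)) _ _).1 hj
  let e' : B' ⊗[LaurentSeries A] M ≃ₗ[B'] (Fin d → B') := e
  have hfree' : Module.Free (PowerSeries (A ⧸ I)) (PowerSeries (A ⧸ I) ⊗[PowerSeries A] L) := hfree
  have hrank : Module.finrank (PowerSeries (A ⧸ I)) (PowerSeries (A ⧸ I) ⊗[PowerSeries A] L) = d :=
    finrank_eq_of_isBaseChange (K := K) hjB e'
      (TensorProduct.isBaseChange (PowerSeries A) L (PowerSeries (A ⧸ I)))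
  let b : Module.Basis (Fin d) (PowerSeries (A ⧸ I)) N :=
    (Module.finBasis (PowerSeries (A ⧸ I)) N).reindex (finCongr hrank)
  choose w hw using fun i => ScalarExtension.exists_eq_tmul_one hq (b i)
  refine ⟨w, fun x => ?_⟩
  choose s hs using fun i => hq (b.repr (ScalarExtension.tmul q 1 x) i)
  refine ⟨s, ?_⟩
  let D := AddMonoidHom.mk' (ScalarExtension.tmul q (1 : PowerSeries (A ⧸ I)) : L → _)
    (ScalarExtension.tmul_add q 1)
  have h1 : D (x - ∑ i, s i • w i) = 0 := by
    rw [map_sub, map_sum, sub_eq_zero]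
    refine (b.sum_repr _).symm.trans (Finset.sum_congr rfl fun i _ => ?_)
    change _ = ScalarExtension.tmul q 1 (s i • w i)
    rw [ScalarExtension.tmul_smul, one_mul, ScalarExtension.tmul_eq_smul, hw, hs]
    rfl
  have h2 := hzero _ h1
  rw [smul_sub, sub_eq_zero, Finset.smul_sum] at h2
  rw [h2]
  exact Finset.sum_congr rfl fun i _ => smul_comm _ _ _

/-- A lattice in a module over `A((u))`, for a finite product `A` of fields, is generated by
`d` elements if the module becomes free of rank `d` after an injective base change. -/
theorem exists_generators_of_isReduced [IsArtinianRing A] [IsReduced A]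
    [Module.Finite (PowerSeries A) L]
    (hX : ∀ x : L, (PowerSeries.X : PowerSeries A) • x = 0 → x = 0)
    [IsLocalizedModule (Submonoid.powers (PowerSeries.X : PowerSeries A)) j]
    (e : ScalarExtension θ M ≃ₗ[B'] (Fin d → B')) (hθ : Function.Injective θ) :
    ∃ w : Fin d → L, Submodule.span (PowerSeries A) (Set.range w) = ⊤ := by
  classical
  have := Fintype.ofFinite (MaximalSpectrum A)
  let E := IsArtinianRing.equivPi A
  let ε : MaximalSpectrum A → A := fun I => E.symm (Pi.single I 1)
  have hE : ∀ (a : A) (I : MaximalSpectrum A), E a I = Ideal.Quotient.mk _ a :=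
    fun _ _ => rfl
  have hEε : ∀ I, E (ε I) = Pi.single I 1 := fun I => E.apply_symm_apply _
  have hsum : ∑ I, ε I = 1 := by
    apply E.injective
    rw [map_sum, map_one]
    simp only [hEε]
    exact Finset.univ_sum_single 1
  have hmul : ∀ I J, ε I * ε J = if I = J then ε I else 0 := fun I J => by
    apply E.injective
    rw [map_mul, hEε, hEε]
    split_ifs with h
    · subst h
      rw [hEε, ← Pi.single_mul, one_mul]
    · rw [map_zero]
      funext K
      rw [Pi.mul_apply, Pi.zero_apply]
      rcases eq_or_ne K I with rfl | hK
      · rw [Pi.single_eq_of_ne h, mul_zero]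
      · rw [Pi.single_eq_of_ne hK, zero_mul]
  have hmem : ∀ I, 1 - ε I ∈ I.asIdeal := fun I => by
    rw [← Ideal.Quotient.eq_zero_iff_mem, ← hE, map_sub, hEε, map_one]
    simp
  have hann : ∀ I, ∀ a ∈ I.asIdeal, ε I * a = 0 := fun I a ha => by
    apply E.injective
    rw [map_mul, hEε, map_zero]
    funext K
    rw [Pi.mul_apply, Pi.zero_apply]
    rcases eq_or_ne K I with rfl | hK
    · rw [hE, Ideal.Quotient.eq_zero_iff_mem.2 ha, mul_zero]
    · rw [Pi.single_eq_of_ne hK, zero_mul]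
  have hne : ∀ I, θ (HahnSeries.C (ε I)) ≠ 0 := fun I h => by
    rw [map_eq_zero_iff θ hθ, map_eq_zero_iff _ HahnSeries.C_injective] at h
    have := I.isMaximal
    have h1 := congrFun (hEε I) I
    rw [h, map_zero, Pi.single_eq_same] at h1
    have := Ideal.Quotient.nontrivial_iff.2 I.isMaximal.ne_top
    exact zero_ne_one h1
  have key := fun I : MaximalSpectrum A =>
    have := I.isMaximal
    exists_generators_of_idempotent (j := j) hX e I.asIdeal (hmem I) (hann I) (hne I)
  choose w hw using key
  -- The same `d` occurs in every component, so the generators can be glued by orthogonal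
  -- idempotents.
  let v : Fin d → L := fun i => ∑ I, (PowerSeries.C (ε I) : PowerSeries A) • w I i
  have hv : ∀ I i, (PowerSeries.C (ε I) : PowerSeries A) • v i =
      (PowerSeries.C (ε I) : PowerSeries A) • w I i := fun I i => by
    rw [Finset.smul_sum, Finset.sum_eq_single I]
    · rw [smul_smul, ← map_mul, hmul, if_pos rfl]
    · intro J _ hJ
      rw [smul_smul, ← map_mul, hmul, if_neg hJ.symm, map_zero, zero_smul]
    · simp
  refine ⟨v, eq_top_iff.2 fun x _ => ?_⟩
  have hx : x = ∑ I, (PowerSeries.C (ε I) : PowerSeries A) • x := by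
    rw [← Finset.sum_smul, ← map_sum, hsum, map_one, one_smul]
  rw [hx]
  refine sum_mem fun I _ => ?_
  obtain ⟨s, hs⟩ := hw I x
  rw [hs]
  refine sum_mem fun i _ => ?_
  rw [← hv]
  exact Submodule.smul_mem _ _ (Submodule.smul_mem _ _ (Submodule.subset_span ⟨i, rfl⟩))

end Rank

namespace PhiModule

variable {p : ℕ} [Fact p.Prime] {k : Type u} [Field k] [Algebra (ZMod p) k] {d : ℕ}
  {R S : Type u} [CommRing R] [Algebra (ZMod p) R] [CommRing S] [Algebra (ZMod p) S]

theorem IsLatticeOfHeightLEOne.exists_generators {M : PhiModule p k d R} {e : ℕ}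
    {L : Submodule (IntegralRing p k R) M.carrier} [IsArtinianRing (CoeffRing p k R)]
    [IsReduced (CoeffRing p k R)] (h : M.IsLatticeOfHeightLEOne e L) :
    ∃ w : Fin d → M.carrier, Submodule.span (IntegralRing p k R) (Set.range w) = L := by
  obtain ⟨R', _, _, f, hf, ⟨E⟩⟩ := M.locallyFree
  have := h.localization
  have : Module.Finite (IntegralRing p k R) L := Module.Finite.iff_fg.2 h.fg
  obtain ⟨w, hw⟩ := exists_generators_of_isReduced (j := L.subtype) (fun x hx => Subtype.ext
    (M.X_pow_smul_injective 1 (by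
      rw [pow_one]
      exact (congrArg Subtype.val hx).trans (smul_zero (PowerSeries.X : IntegralRing p k R)).symm))) E
    (laurentMap_injective (coeffBaseChange_injective k hf.injective))
  refine ⟨fun i => w i, ?_⟩
  have h1 := congrArg (Submodule.map L.subtype) hw
  rw [Submodule.map_span, Submodule.map_top, Submodule.range_subtype, ← Set.range_comp] at h1
  exact h1

theorem IsLatticeOfHeightLEOne.span_laurent_eq_top {M : PhiModule p k d R} {e : ℕ}
    {L : Submodule (IntegralRing p k R) M.carrier} (h : M.IsLatticeOfHeightLEOne e L)
    {w : Fin d → M.carrier} (hw : Submodule.span (IntegralRing p k R) (Set.range w) = L) :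
    Submodule.span (LaurentRing p k R) (Set.range w) = ⊤ := by
  refine eq_top_iff.2 fun x _ => ?_
  obtain ⟨N, hN⟩ := h.exists_X_pow_smul_mem x
  rw [← hw] at hN
  have h1 := Submodule.span_le_restrictScalars (IntegralRing p k R) (LaurentRing p k R) _ hN
  rwa [Submodule.restrictScalars_mem, integral_smul_def,
    Submodule.smul_mem_iff_of_isUnit _ (isUnit_algebraMap_X_pow N)] at h1

/-- A generating family of `d` elements is a basis. -/
theorem linearIndependent_of_span_eq_top {M : PhiModule p k d R} {w : Fin d → M.carrier}
    (hw : Submodule.span (LaurentRing p k R) (Set.range w) = ⊤) :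
    LinearIndependent (LaurentRing p k R) w := by
  obtain ⟨R', _, _, f, hf, ⟨E⟩⟩ := M.locallyFree
  let β := laurentBaseChange p k f
  have hβ : Function.Injective β :=
    laurentMap_injective (coeffBaseChange_injective k hf.injective)
  let D := AddMonoidHom.mk' (ScalarExtension.tmul β 1 : M.carrier → _) (ScalarExtension.tmul_add β 1)
  have hD : ∀ b m, D (b • m) = β b • D m := fun b m => by
    change ScalarExtension.tmul β 1 (b • m) = β b • ScalarExtension.tmul β 1 m
    rw [ScalarExtension.tmul_smul, one_mul, ScalarExtension.tmul_eq_smul]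
  have hDsum : ∀ c : Fin d → LaurentRing p k R,
      D (∑ i, c i • w i) = ∑ i, β (c i) • D (w i) := fun c => by
    rw [map_sum]
    exact Finset.sum_congr rfl fun i _ => hD _ _
  -- Over `R'` the family becomes an endomorphism of a free module of rank `d`. It is surjective,
  -- hence injective, and injectivity of `β` brings linear independence back to `R`.
  let F : (Fin d → LaurentRing p k R') →ₗ[LaurentRing p k R'] (Fin d → LaurentRing p k R') :=
    Fintype.linearCombination _ fun i => E (D (w i))
  have hF : ∀ c, F c = E (∑ i, c i • D (w i)) := fun c => by
    rw [map_sum]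
    simp only [map_smul]
    rfl
  have hsurj : Function.Surjective F := fun y => by
    have key : ∀ t, E t ∈ LinearMap.range F := fun t => by
      induction t using ScalarExtension.induction_on with
      | zero => rw [map_zero]; exact zero_mem _
      | tmul b m =>
        rw [ScalarExtension.tmul_eq_smul, map_smul]
        refine Submodule.smul_mem _ _ ?_
        obtain ⟨c, rfl⟩ := Submodule.mem_span_range_iff_exists_fun _ |>.1
          (hw ▸ Submodule.mem_top : m ∈ Submodule.span _ (Set.range w))
        refine ⟨fun i => β (c i), ?_⟩
        rw [hF, ← hDsum]
        rfl
      | add x y hx hy => rw [map_add]; exact add_mem hx hy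
    simpa using key (E.symm y)
  have hinj := OrzechProperty.injective_of_surjective_endomorphism F hsurj
  rw [Fintype.linearIndependent_iff]
  intro c hc
  have h1 : F (fun i => β (c i)) = 0 := by
    rw [hF, ← hDsum, hc, map_zero, map_zero]
  have h2 := hinj (h1.trans (map_zero F).symm)
  exact fun i => hβ ((congrFun h2 i).trans (map_zero β).symm)

end PhiModule

/-! ### Stabilization of descending chains of lattices -/

instance PowerSeries.finite_quotient_span_X_pow {A : Type*} [CommRing A] [Finite A] (n : ℕ) :
    Finite (PowerSeries A ⧸ Ideal.span {(PowerSeries.X : PowerSeries A) ^ n}) := by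
  refine Finite.of_surjective (fun c : Fin n → A => Ideal.Quotient.mk _
    (PowerSeries.mk fun i => if h : i < n then c ⟨i, h⟩ else 0)) fun y => ?_
  obtain ⟨f, rfl⟩ := Ideal.Quotient.mk_surjective y
  refine ⟨fun i => PowerSeries.coeff i f, Ideal.Quotient.eq.2 ?_⟩
  rw [Ideal.mem_span_singleton, PowerSeries.X_pow_dvd_iff]
  intro m hm
  simp [hm]

/-- A descending sequence of submodules between `L` and `u ^ e L` is stationary, for a finitely
generated module `L` over the power series over a finite ring. -/
theorem exists_stable_of_antitone {A M : Type*} [CommRing A] [Finite A] [AddCommGroup M]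
    [Module (PowerSeries A) M] {f : ℕ → Submodule (PowerSeries A) M} (hf : Antitone f)
    (hfg : (f 0).FG) {e : ℕ}
    (he : ∀ i, ∀ m ∈ f 0, (PowerSeries.X ^ e : PowerSeries A) • m ∈ f i) :
    ∃ n, ∀ m, n ≤ m → f m = f n := by
  let I : Ideal (PowerSeries A) := Ideal.span {(PowerSeries.X : PowerSeries A) ^ e}
  have : Module.Finite (PowerSeries A) (f 0) := Module.Finite.iff_fg.2 hfg
  -- `Q = f 0 / u^e f 0` is finite, so the images of the `f i` in it stabilize; as `f i` contains
  -- `u^e f 0`, it is determined by its image.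
  let Q := f 0 ⧸ (I • ⊤ : Submodule (PowerSeries A) (f 0))
  have : Module.Finite (PowerSeries A ⧸ I) Q :=
    Module.Finite.of_restrictScalars_finite (PowerSeries A) _ _
  have : Finite Q := Module.finite_of_finite (PowerSeries A ⧸ I)
  let g : ℕ →o (Submodule (PowerSeries A) Q)ᵒᵈ :=
    ⟨fun i => OrderDual.toDual (((f i).comap (f 0).subtype).map (Submodule.mkQ _)),
      fun i j hij => Submodule.map_mono (Submodule.comap_mono (hf hij))⟩
  obtain ⟨n, hn⟩ := IsArtinian.monotone_stabilizes g
  refine ⟨n, fun m hm => le_antisymm (hf hm) fun x hx => ?_⟩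
  have hx0 : x ∈ f 0 := hf (Nat.zero_le n) hx
  have h1 : Submodule.mkQ (I • ⊤ : Submodule (PowerSeries A) (f 0)) ⟨x, hx0⟩ ∈
      ((f m).comap (f 0).subtype).map (Submodule.mkQ _) := by
    have : Submodule.mkQ (I • ⊤ : Submodule (PowerSeries A) (f 0)) ⟨x, hx0⟩ ∈
      ((f n).comap (f 0).subtype).map (Submodule.mkQ _) := ⟨⟨x, hx0⟩, hx, rfl⟩
    have h2 : ((f n).comap (f 0).subtype).map (Submodule.mkQ (I • ⊤)) =
      ((f m).comap (f 0).subtype).map (Submodule.mkQ (I • ⊤)) := hn m hm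
    rwa [h2] at this
  obtain ⟨y, hy, hyx⟩ := h1
  rw [← sub_eq_zero, ← map_sub, Submodule.mkQ_apply, Submodule.Quotient.mk_eq_zero,
    Submodule.ideal_span_singleton_smul, Submodule.mem_smul_pointwise_iff_exists] at hyx
  obtain ⟨z, -, hz⟩ := hyx
  have h3 : (y : M) - x = (PowerSeries.X ^ e : PowerSeries A) • (z : M) :=
    (congrArg Subtype.val hz).symm
  have h4 : x = y - (PowerSeries.X ^ e : PowerSeries A) • (z : M) := by rw [← h3, sub_sub_cancel]
  rw [h4]
  exact sub_mem hy (he m z z.2)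

/-! ### The rings `𝒪_F / ϖ^{n+1}` and their tensor products with `k` -/

section TruncRing

variable (p : ℕ) [Fact p.Prime] (l : Type u) [Field l] [Algebra (ZMod p) l]

/-- The class of `ϖ` in `𝒪_F / ϖ^{n+1}`. -/
def truncX (n : ℕ) : TruncRing l n := Ideal.Quotient.mk _ PowerSeries.X

theorem truncSucc_mk (n : ℕ) (f : PowerSeries l) :
    truncSucc p l n (Ideal.Quotient.mk _ f) = Ideal.Quotient.mk _ f := rfl

theorem toTrunc_apply (n : ℕ) (f : PowerSeries l) : toTrunc p l n f = Ideal.Quotient.mk _ f := rfl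

theorem truncSucc_surjective (n : ℕ) : Function.Surjective (truncSucc p l n) := fun y => by
  obtain ⟨f, rfl⟩ := Ideal.Quotient.mk_surjective y
  exact ⟨Ideal.Quotient.mk _ f, rfl⟩

theorem truncSucc_truncX (n : ℕ) : truncSucc p l n (truncX l (n + 1)) = truncX l n := rfl

theorem truncX_pow (n : ℕ) : truncX l n ^ (n + 1) = 0 := by
  rw [truncX, ← map_pow, Ideal.Quotient.eq_zero_iff_mem]
  exact Ideal.mem_span_singleton_self _

theorem mk_eq_zero_iff {n : ℕ} {f : PowerSeries l} :
    (Ideal.Quotient.mk _ f : TruncRing l n) = 0 ↔ PowerSeries.X ^ (n + 1) ∣ f := by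
  rw [Ideal.Quotient.eq_zero_iff_mem, Ideal.mem_span_singleton]

theorem exists_eq_of_truncSucc_eq_zero {n : ℕ} {x : TruncRing l (n + 1)}
    (hx : truncSucc p l n x = 0) : ∃ y, x = truncX l (n + 1) ^ (n + 1) * y := by
  obtain ⟨f, rfl⟩ := Ideal.Quotient.mk_surjective x
  rw [truncSucc_mk, mk_eq_zero_iff] at hx
  obtain ⟨g, rfl⟩ := hx
  exact ⟨Ideal.Quotient.mk _ g, by rw [map_mul, map_pow]; rfl⟩

theorem exists_eq_of_truncX_mul_eq_zero {n : ℕ} {x : TruncRing l (n + 1)}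
    (hx : truncX l (n + 1) * x = 0) : ∃ y, x = truncX l (n + 1) ^ (n + 1) * y := by
  obtain ⟨f, rfl⟩ := Ideal.Quotient.mk_surjective x
  rw [truncX, ← map_mul, mk_eq_zero_iff, pow_succ', mul_dvd_mul_iff_left PowerSeries.X_ne_zero] at hx
  obtain ⟨g, rfl⟩ := hx
  exact ⟨Ideal.Quotient.mk _ g, by rw [map_mul, map_pow]; rfl⟩

end TruncRing

section Coeff

variable {p : ℕ} [Fact p.Prime] (k : Type u) [Field k] [Algebra (ZMod p) k]
  {R S : Type u} [CommRing R] [Algebra (ZMod p) R] [CommRing S] [Algebra (ZMod p) S]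

theorem rTensor_mulLeft (r : R) (a : CoeffRing p k R) :
    (LinearMap.mulLeft (ZMod p) r).rTensor k a = (r ⊗ₜ 1) * a := by
  induction a using TensorProduct.induction_on with
  | zero => rw [map_zero, mul_zero]
  | tmul x y => simp
  | add x y hx hy => rw [map_add, mul_add, hx, hy]

theorem exists_eq_of_coeffBaseChange_eq_zero {f : R →ₐ[ZMod p] S} (hf : Function.Surjective f)
    {r : R} (hr : f r = 0) (hfr : ∀ x, f x = 0 → ∃ y, x = r * y) {a : CoeffRing p k R}
    (ha : coeffBaseChange k f a = 0) : ∃ b, a = (r ⊗ₜ 1) * b := by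
  have h : Function.Exact (LinearMap.mulLeft (ZMod p) r) f.toLinearMap := fun x => by
    refine ⟨fun hx => ?_, ?_⟩
    · obtain ⟨y, rfl⟩ := hfr x hx
      exact ⟨y, rfl⟩
    · rintro ⟨y, rfl⟩
      change f (r * y) = 0
      rw [map_mul, hr, zero_mul]
  obtain ⟨b, rfl⟩ := (rTensor_exact k h hf a).1 ha
  exact ⟨b, rTensor_mulLeft k r b⟩

theorem exists_eq_of_tmul_one_mul_eq_zero {r s : R} (hsr : s * r = 0)
    (hr : ∀ x, s * x = 0 → ∃ y, x = r * y) {a : CoeffRing p k R}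
    (ha : (s ⊗ₜ 1) * a = 0) : ∃ b, a = (r ⊗ₜ 1) * b := by
  have h : Function.Exact (LinearMap.mulLeft (ZMod p) r) (LinearMap.mulLeft (ZMod p) s) :=
    fun x => by
      refine ⟨fun hx => ?_, ?_⟩
      · obtain ⟨y, rfl⟩ := hr x hx
        exact ⟨y, rfl⟩
      · rintro ⟨y, rfl⟩
        change s * (r * y) = 0
        rw [← mul_assoc, hsr, zero_mul]
  rw [← rTensor_mulLeft] at ha
  obtain ⟨b, rfl⟩ := (Module.Flat.rTensor_exact k h a).1 ha
  exact ⟨b, rTensor_mulLeft k r b⟩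

instance [Finite k] [Finite R] : Finite (CoeffRing p k R) :=
  Module.finite_of_finite R

variable (l : Type u) [Field l] [Algebra (ZMod p) l]

theorem truncSucc_coeff_ker {n : ℕ} {a : CoeffRing p k (TruncRing l (n + 1))}
    (ha : coeffBaseChange k (truncSucc p l n) a = 0) :
    ∃ b, a = ((truncX l (n + 1) ^ (n + 1)) ⊗ₜ 1) * b :=
  exists_eq_of_coeffBaseChange_eq_zero k (truncSucc_surjective p l n)
    (by rw [map_pow, truncSucc_truncX, truncX_pow])
    (fun _ hx => exists_eq_of_truncSucc_eq_zero p l hx) ha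

/-- The annihilator of `ϖ` in `𝒪_F / ϖ^{n+2}` is generated by `ϖ^{n+1}`, and this persists after the
flat extension by `k`. It is what makes division by `ϖ` well defined one level below. -/
theorem truncSucc_coeff_ann {n : ℕ} {a : CoeffRing p k (TruncRing l (n + 1))}
    (ha : (truncX l (n + 1) ⊗ₜ 1) * a = 0) : coeffBaseChange k (truncSucc p l n) a = 0 := by
  obtain ⟨b, rfl⟩ := exists_eq_of_tmul_one_mul_eq_zero k
    (by rw [← pow_succ', truncX_pow]) (fun _ hx => exists_eq_of_truncX_mul_eq_zero l hx) ha
  rw [map_mul, coeffBaseChange_tmul, map_pow, truncSucc_truncX, truncX_pow,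
    TensorProduct.zero_tmul, zero_mul]

/-- `𝒪_F / ϖ` embeds into `l`, and `l ⊗ k` is reduced because `k` is separable over `𝔽_p`. -/
theorem isReduced_coeffRing_truncRing_zero [Finite k] :
    IsReduced (CoeffRing p k (TruncRing l 0)) := by
  let f : TruncRing l 0 →ₐ[ZMod p] l := Ideal.Quotient.liftₐ _
    ({ PowerSeries.constantCoeff (R := l) with
        commutes' := fun r => by
          rw [IsScalarTower.algebraMap_apply (ZMod p) l (PowerSeries l)]
          simp } : PowerSeries l →ₐ[ZMod p] l) (fun a ha => by
        rw [zero_add, pow_one, Ideal.mem_span_singleton, PowerSeries.X_dvd_iff] at ha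
        exact ha)
  have hf : Function.Injective f := by
    rw [injective_iff_map_eq_zero]
    intro x hx
    obtain ⟨g, rfl⟩ := Ideal.Quotient.mk_surjective x
    rw [mk_eq_zero_iff, zero_add, pow_one, PowerSeries.X_dvd_iff]
    exact hx
  have : Algebra.FormallyUnramified (ZMod p) k := Algebra.FormallyUnramified.of_isSeparable _ _
  have : IsReduced (CoeffRing p k l) :=
    Algebra.FormallyUnramified.isReduced_of_field l (CoeffRing p k l)
  exact isReduced_of_injective (coeffBaseChange k f) (coeffBaseChange_injective k hf)

end Coeff

/-! ### Lifting generators along nilpotent thickenings -/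

namespace PhiModule.BaseChangeIso

variable {p : ℕ} [Fact p.Prime] {k : Type u} [Field k] [Algebra (ZMod p) k] {d : ℕ}
  {R S : Type u} [CommRing R] [Algebra (ZMod p) R] [CommRing S] [Algebra (ZMod p) S]
  {f : R →ₐ[ZMod p] S} {M : PhiModule p k d R} {N : PhiModule p k d S} (g : BaseChangeIso f M N)

/-- Nakayama's lemma for the kernel `r M` with `r^2 = 0`: approximating an element modulo `r`, and
then the error term once more, leaves no remainder. -/
theorem span_laurent_eq_top_of_red (hf : Function.Surjective f) {r : R} (hr2 : r * r = 0)
    (hr : ∀ a, coeffBaseChange k f a = 0 → ∃ b, a = (r ⊗ₜ 1) * b) {w : Fin d → M.carrier}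
    (hw : Submodule.span (LaurentRing p k S) (Set.range fun i => g.red (w i)) = ⊤) :
    Submodule.span (LaurentRing p k R) (Set.range w) = ⊤ := by
  have key : ∀ x : M.carrier, ∃ y ∈ Submodule.span (LaurentRing p k R) (Set.range w), ∃ z,
      x = y + integralScalar k p r • z := fun x => by
    obtain ⟨c, hc⟩ := (Submodule.mem_span_range_iff_exists_fun _).1
      (hw ▸ Submodule.mem_top : g.red x ∈ Submodule.span _ _)
    choose b hb using fun i => laurentMap_surjective (coeffBaseChange_surjective k hf) (c i)
    have h1 : g.red (x - ∑ i, b i • w i) = 0 := by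
      rw [red_sub, red_sum, sub_eq_zero, ← hc]
      refine Finset.sum_congr rfl fun i _ => ?_
      rw [red_smul, laurentBaseChange_eq, hb]
    obtain ⟨z, hz⟩ := g.exists_eq_smul_of_red_eq_zero hf hr h1
    exact ⟨_, sum_mem fun i _ => Submodule.smul_mem _ (b i) (Submodule.subset_span ⟨i, rfl⟩), z,
      (sub_eq_iff_eq_add'.1 hz)⟩
  refine eq_top_iff.2 fun x _ => ?_
  obtain ⟨y, hy, z, rfl⟩ := key x
  obtain ⟨y', hy', z', rfl⟩ := key z
  have h0 : integralScalar k p r * integralScalar k p r = 0 := by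
    rw [← integralScalar_mul, hr2, integralScalar, TensorProduct.zero_tmul, map_zero]
  rw [smul_add, smul_smul, h0]
  refine add_mem hy (add_mem (Submodule.smul_mem _ _ hy') ?_)
  have : (0 : IntegralRing p k R) • z' = 0 := zero_smul (IntegralRing p k R) z'
  rw [this]
  exact zero_mem _

/-- The spanning family `w` is a basis, so the hypothesis on coefficients can be applied coordinate
by coordinate. -/
theorem red_eq_zero_of_smul_eq_zero {r : R}
    (hr : ∀ a, (r ⊗ₜ 1) * a = 0 → coeffBaseChange k f a = 0) {w : Fin d → M.carrier}
    (hw : Submodule.span (LaurentRing p k R) (Set.range w) = ⊤) {m : M.carrier}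
    (hm : integralScalar k p r • m = 0) : g.red m = 0 := by
  obtain ⟨c, rfl⟩ := (Submodule.mem_span_range_iff_exists_fun _).1
    (hw ▸ Submodule.mem_top : m ∈ Submodule.span _ _)
  rw [integral_smul_def, integralScalar, algebraMap_C, Finset.smul_sum] at hm
  simp only [smul_smul] at hm
  have h := Fintype.linearIndependent_iff.1 (linearIndependent_of_span_eq_top hw) _ hm
  rw [red_sum]
  refine Finset.sum_eq_zero fun i _ => ?_
  rw [red_smul, laurentBaseChange_eq, laurentMap_eq_zero_of_C_mul_eq_zero hr (h i)]
  exact zero_smul (LaurentRing p k S) (g.red (w i))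

/-- Nakayama's lemma for a lift of a generating family along a nilpotent thickening. -/
theorem span_integral_eq_of_red (hf : Function.Surjective f) {r s : R} {N₀ : ℕ}
    (hr : ∀ a, coeffBaseChange k f a = 0 → ∃ b, a = ((r * s) ⊗ₜ 1) * b) (hrN : r ^ N₀ = 0)
    {L : Submodule (IntegralRing p k R) M.carrier}
    (hL : ∀ x ∈ L, ∀ y, x = integralScalar k p r • y → ∃ x' ∈ L, x = integralScalar k p r • x')
    {w : Fin d → M.carrier} (hwL : ∀ i, w i ∈ L)
    (hw : Submodule.span (IntegralRing p k S) (Set.range fun i => g.red (w i)) =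
      g.redImage hf L) :
    Submodule.span (IntegralRing p k R) (Set.range w) = L := by
  set F := Submodule.span (IntegralRing p k R) (Set.range w) with hF
  have hFL : F ≤ L := Submodule.span_le.2 (by rintro _ ⟨i, rfl⟩; exact hwL i)
  have key : ∀ x ∈ L, ∃ y ∈ F, ∃ z ∈ L, x = y + integralScalar k p r • z := fun x hx => by
    have h0 : g.red x ∈ g.redImage hf L := ⟨x, hx, rfl⟩
    rw [← hw] at h0
    obtain ⟨c, hc⟩ := (Submodule.mem_span_range_iff_exists_fun _).1 h0
    choose b hb using fun i => integralBaseChange_surjective k hf (c i)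
    have hy : ∑ i, b i • w i ∈ F :=
      sum_mem fun i _ => Submodule.smul_mem _ (b i) (Submodule.subset_span ⟨i, rfl⟩)
    have h1 : g.red (x - ∑ i, b i • w i) = 0 := by
      rw [red_sub, red_sum, sub_eq_zero, ← hc]
      refine Finset.sum_congr rfl fun i _ => ?_
      rw [red_integral_smul, hb]
    obtain ⟨z, hz⟩ := g.exists_eq_smul_of_red_eq_zero hf hr h1
    have hz' : x - ∑ i, b i • w i = integralScalar k p r • (integralScalar k p s • z) := by
      rw [hz, smul_smul, integralScalar_mul]
    -- The error is a multiple of `r` in `M` only; saturation `hL` moves the quotient into `L`, so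
    -- that the approximation can be iterated inside `L`.
    obtain ⟨x', hx', hxx'⟩ := hL _ (sub_mem hx (hFL hy)) _ hz'
    exact ⟨_, hy, x', hx', sub_eq_iff_eq_add'.1 hxx'⟩
  have iter : ∀ n, ∀ x ∈ L, ∃ y ∈ F, ∃ z ∈ L, x = y + integralScalar k p r ^ n • z := by
    intro n
    induction n with
    | zero => exact fun x hx => ⟨0, zero_mem _, x, hx, by rw [pow_zero, one_smul, zero_add]⟩
    | succ n ih =>
      intro x hx
      obtain ⟨y, hy, z, hz, rfl⟩ := ih x hx
      obtain ⟨y', hy', z', hz', rfl⟩ := key z hz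
      exact ⟨y + integralScalar k p r ^ n • y', add_mem hy (F.smul_mem _ hy'), z', hz', by
        rw [smul_add, smul_smul, ← pow_succ, add_assoc]⟩
  refine le_antisymm hFL fun x hx => ?_
  obtain ⟨y, hy, z, hz, rfl⟩ := iter N₀ x hx
  have h0 : integralScalar k p r ^ N₀ = 0 := by
    rw [integralScalar, ← map_pow, Algebra.TensorProduct.tmul_pow, hrN,
      TensorProduct.zero_tmul, map_zero]
  have h1 : integralScalar k p r ^ N₀ • z = 0 := by
    rw [h0]; exact zero_smul (IntegralRing p k R) z
  rwa [h1, add_zero]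

end PhiModule.BaseChangeIso

/-! ### Stable lattices of a formal point -/

namespace FormalPoint

open PhiModule

variable {p : ℕ} [Fact p.Prime] {k : Type u} [Field k] [Algebra (ZMod p) k]
  {l : Type u} [Field l] [Algebra (ZMod p) l] {d : ℕ} (M : FormalPoint p l k d) (e : ℕ)

/-- The image of the largest submodule of height at most `e` of `M_{n+m}` in `M_n`. -/
def imageLattice : (m n : ℕ) → Submodule (IntegralRing p k (TruncRing l n)) (M.obj n).carrier
  | 0, n => (M.obj n).maxLattice e
  | m + 1, n => (M.trans n).redImage (truncSucc_surjective p l n) (imageLattice m (n + 1))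

/-- The stable image in `M_n` of the largest submodules of height at most `e`. -/
def stableLattice (n : ℕ) : Submodule (IntegralRing p k (TruncRing l n)) (M.obj n).carrier :=
  ⨅ m, M.imageLattice e m n

variable [Finite k] [Finite l] {M e}

/-- This makes every `M_n` free, which is needed to identify the kernel of `ϖ` on `M_{n+1}`. The
case `n = 0` uses a lattice; the others use lifting along a square-zero ideal. -/
theorem exists_span_eq_top
    (hM : ∀ n : ℕ, ∃ L : Submodule (IntegralRing p k (TruncRing l n)) (M.obj n).carrier,
      (M.obj n).IsLatticeOfHeightLEOne e L) (n : ℕ) :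
    ∃ w : Fin d → (M.obj n).carrier,
      Submodule.span (LaurentRing p k (TruncRing l n)) (Set.range w) = ⊤ := by
  induction n with
  | zero =>
    obtain ⟨L, hL⟩ := hM 0
    have := isReduced_coeffRing_truncRing_zero (p := p) k l
    obtain ⟨w, hw⟩ := hL.exists_generators
    exact ⟨w, hL.span_laurent_eq_top hw⟩
  | succ n ih =>
    obtain ⟨w, hw⟩ := ih
    choose v hv using fun i => (M.trans n).red_surjective (truncSucc_surjective p l n) (w i)
    refine ⟨v, (M.trans n).span_laurent_eq_top_of_red (truncSucc_surjective p l n)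
      (r := truncX l (n + 1) ^ (n + 1)) ?_ (fun a ha => truncSucc_coeff_ker k l ha) ?_⟩
    · rw [← pow_add, show n + 1 + (n + 1) = (n + 1 + 1) + n by ring, pow_add, truncX_pow, zero_mul]
    · simpa only [hv] using hw

section

variable (hM : ∀ n : ℕ, ∃ L : Submodule (IntegralRing p k (TruncRing l n)) (M.obj n).carrier,
      (M.obj n).IsLatticeOfHeightLEOne e L)
include hM

theorem isLattice_imageLattice (m n : ℕ) :
    (M.obj n).IsLatticeOfHeightLEOne e (M.imageLattice e m n) := by
  induction m generalizing n with
  | zero =>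
    obtain ⟨L, hL⟩ := hM n
    exact hL.isLattice_maxLattice
  | succ m ih => exact (M.trans n).isLattice_redImage (truncSucc_surjective p l n) (ih (n + 1))

theorem imageLattice_succ_le (m n : ℕ) : M.imageLattice e (m + 1) n ≤ M.imageLattice e m n := by
  induction m generalizing n with
  | zero => exact (isLattice_imageLattice hM 1 n).le_maxLattice
  | succ m ih => exact (M.trans n).redImage_mono (ih (n + 1))

theorem imageLattice_antitone (n : ℕ) : Antitone fun m => M.imageLattice e m n :=
  antitone_nat_of_succ_le fun m => imageLattice_succ_le hM m n

/-- All images are lattices of height at most `e`, so each contains `u^e` times the first and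
`exists_stable_of_antitone` applies. -/
theorem exists_stableLattice_eq (n : ℕ) :
    ∃ m₀, ∀ m, m₀ ≤ m → M.imageLattice e m n = M.stableLattice e n := by
  obtain ⟨m₀, hm₀⟩ := exists_stable_of_antitone (imageLattice_antitone hM n)
    (isLattice_imageLattice hM 0 n).fg (e := e) (fun i m hm =>
      (isLattice_imageLattice hM i n).X_pow_smul_mem (isLattice_imageLattice hM 0 n) hm)
  refine ⟨m₀, fun m hm => le_antisymm (le_iInf fun i => ?_) (iInf_le _ m)⟩
  rcases le_total m₀ i with hi | hi
  · exact ((hm₀ m hm).trans (hm₀ i hi).symm).le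
  · exact imageLattice_antitone hM n (hi.trans hm)

theorem isLattice_stableLattice (n : ℕ) :
    (M.obj n).IsLatticeOfHeightLEOne e (M.stableLattice e n) := by
  obtain ⟨m₀, hm₀⟩ := exists_stableLattice_eq hM n
  rw [← hm₀ m₀ le_rfl]
  exact isLattice_imageLattice hM m₀ n

theorem redImage_stableLattice (n : ℕ) :
    (M.trans n).redImage (truncSucc_surjective p l n) (M.stableLattice e (n + 1)) =
      M.stableLattice e n := by
  obtain ⟨m₀, hm₀⟩ := exists_stableLattice_eq hM n
  obtain ⟨m₁, hm₁⟩ := exists_stableLattice_eq hM (n + 1)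
  rw [← hm₁ (max m₀ m₁) (le_max_right _ _),
    ← hm₀ (max m₀ m₁ + 1) ((le_max_left _ _).trans (Nat.le_succ _))]
  rfl

/-- Saturation, at the cost of one level. Let `x` be the reduction of `x'` in the largest lattice of
`M_{n+1}`. Since `ker(M_{n+1} → M_n) = ϖ^{n+1} M_{n+1}`, divisibility lifts: `x' = ϖ y'`. The
reduction of `y'` lies in the lattice `divImage`, hence in the largest lattice of `M_n`. Larger `m`
follow by induction one level up. For stable lattices the lost level does not matter. -/
theorem exists_smul_eq_of_mem_imageLattice (m n : ℕ) {x y : (M.obj n).carrier}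
    (hx : x ∈ M.imageLattice e (m + 1) n) (hxy : x = integralScalar k p (truncX l n) • y) :
    ∃ x' ∈ M.imageLattice e m n, x = integralScalar k p (truncX l n) • x' := by
  have lift : ∀ (n : ℕ) (x' : (M.obj (n + 1)).carrier) (y : (M.obj n).carrier),
      (M.trans n).red x' = integralScalar k p (truncX l n) • y →
      ∃ y', x' = integralScalar k p (truncX l (n + 1)) • y' := fun n x' y h => by
    obtain ⟨z, rfl⟩ := (M.trans n).red_surjective (truncSucc_surjective p l n) y
    have h1 : (M.trans n).red (x' - integralScalar k p (truncX l (n + 1)) • z) = 0 := by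
      rw [BaseChangeIso.red_sub, h, BaseChangeIso.red_integral_smul,
        integralBaseChange_integralScalar, truncSucc_truncX, sub_self]
    obtain ⟨t, ht⟩ := (M.trans n).exists_eq_smul_of_red_eq_zero (truncSucc_surjective p l n)
      (fun a ha => truncSucc_coeff_ker k l ha) h1
    refine ⟨z + integralScalar k p (truncX l (n + 1) ^ n) • t, ?_⟩
    rw [smul_add, smul_smul, ← sub_eq_iff_eq_add', ht, ← integralScalar_mul,
      pow_succ' (truncX l (n + 1)) n]
  have red_smul : ∀ (n : ℕ) (y : (M.obj (n + 1)).carrier),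
      (M.trans n).red (integralScalar k p (truncX l (n + 1)) • y) =
        integralScalar k p (truncX l n) • (M.trans n).red y := fun n y => by
    rw [BaseChangeIso.red_integral_smul, integralBaseChange_integralScalar, truncSucc_truncX]
  induction m generalizing n x y with
  | zero =>
    obtain ⟨x', hx', rfl⟩ := hx
    obtain ⟨y', rfl⟩ := lift n x' y hxy
    obtain ⟨w, hw⟩ := exists_span_eq_top hM (n + 1)
    have h1 := (M.trans n).isLattice_divImage (truncSucc_surjective p l n)
      (fun m hm => (M.trans n).red_eq_zero_of_smul_eq_zero
        (fun a ha => truncSucc_coeff_ann k l ha) hw hm) (isLattice_imageLattice hM 0 (n + 1))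
    exact ⟨_, h1.le_maxLattice ⟨y', hx', rfl⟩, red_smul n y'⟩
  | succ m ih =>
    obtain ⟨x', hx', rfl⟩ := hx
    obtain ⟨y', hy'⟩ := lift n x' y hxy
    obtain ⟨x'', hx'', rfl⟩ := ih (n + 1) hx' hy'
    exact ⟨_, ⟨x'', hx'', rfl⟩, red_smul n x''⟩

theorem exists_smul_eq_of_mem_stableLattice (n : ℕ) {x y : (M.obj n).carrier}
    (hx : x ∈ M.stableLattice e n) (hxy : x = integralScalar k p (truncX l n) • y) :
    ∃ x' ∈ M.stableLattice e n, x = integralScalar k p (truncX l n) • x' := by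
  obtain ⟨m₀, hm₀⟩ := exists_stableLattice_eq hM n
  rw [← hm₀ (m₀ + 1) (Nat.le_succ _)] at hx
  rw [← hm₀ m₀ le_rfl]
  exact exists_smul_eq_of_mem_imageLattice hM m₀ n hx hxy

/-- The stable lattices have compatible generating families of `d` elements. -/
theorem exists_compatible_generators : ∃ w : ∀ n, Fin d → (M.obj n).carrier,
    (∀ n, Submodule.span (IntegralRing p k (TruncRing l n)) (Set.range (w n)) =
      M.stableLattice e n) ∧ ∀ n i, (M.trans n).red (w (n + 1) i) = w n i := by
  have h0 : ∃ w : Fin d → (M.obj 0).carrier,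
      Submodule.span (IntegralRing p k (TruncRing l 0)) (Set.range w) = M.stableLattice e 0 := by
    have := isReduced_coeffRing_truncRing_zero (p := p) k l
    exact (isLattice_stableLattice hM 0).exists_generators
  have hstep : ∀ n (w : Fin d → (M.obj n).carrier),
      Submodule.span (IntegralRing p k (TruncRing l n)) (Set.range w) = M.stableLattice e n →
      ∃ v : Fin d → (M.obj (n + 1)).carrier,
        Submodule.span (IntegralRing p k (TruncRing l (n + 1))) (Set.range v) =
          M.stableLattice e (n + 1) ∧ ∀ i, (M.trans n).red (v i) = w i := fun n w hw => by
    have h1 : ∀ i, ∃ v ∈ M.stableLattice e (n + 1), (M.trans n).red v = w i := fun i => by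
      have : w i ∈ M.stableLattice e n := hw ▸ Submodule.subset_span ⟨i, rfl⟩
      rwa [← redImage_stableLattice hM n] at this
    choose v hv hvw using h1
    -- The kernel of reduction is `ϖ^{n+1} M_{n+1}`; one factor `ϖ` is split off for saturation, and
    -- `ϖ^{n+2} = 0` ends the iteration.
    refine ⟨v, (M.trans n).span_integral_eq_of_red (truncSucc_surjective p l n)
      (r := truncX l (n + 1)) (s := truncX l (n + 1) ^ n) (N₀ := n + 1 + 1) (fun a ha => ?_)
      (truncX_pow l (n + 1)) (fun x hx y hxy => exists_smul_eq_of_mem_stableLattice hM _ hx hxy)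
      hv ?_, hvw⟩
    · rw [← pow_succ']
      exact truncSucc_coeff_ker k l ha
    · rw [redImage_stableLattice hM n]
      simpa only [hvw] using hw
  choose v hv hvw using hstep
  let W : ∀ n, {w : Fin d → (M.obj n).carrier //
      Submodule.span (IntegralRing p k (TruncRing l n)) (Set.range w) = M.stableLattice e n} :=
    fun n => Nat.rec ⟨h0.choose, h0.choose_spec⟩ (fun n w => ⟨v n w.1 w.2, hv n w.1 w.2⟩) n
  exact ⟨fun n => (W n).1, fun n => (W n).2, fun n => hvw n (W n).1 (W n).2⟩

end

end FormalPoint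

/-! ### Limits over `n` of scalars -/

section Limit

variable {p : ℕ} [Fact p.Prime] {k : Type u} [Field k] [Algebra (ZMod p) k]
  {l : Type u} [Field l] [Algebra (ZMod p) l]

theorem exists_toTrunc_eq {y : ∀ n, TruncRing l n} (hy : ∀ n, truncSucc p l n (y (n + 1)) = y n) :
    ∃ f, ∀ n, toTrunc p l n f = y n := by
  choose f hf using fun n => Ideal.Quotient.mk_surjective (y n)
  have hstep : ∀ n i, i ≤ n → PowerSeries.coeff i (f (n + 1)) = PowerSeries.coeff i (f n) := by
    intro n i hi
    have h : (Ideal.Quotient.mk _ (f (n + 1) - f n) : TruncRing l n) = 0 := by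
      rw [map_sub, sub_eq_zero, ← truncSucc_mk p, hf (n + 1), hy, hf]
    rw [mk_eq_zero_iff, PowerSeries.X_pow_dvd_iff] at h
    have := h i (Nat.lt_succ_of_le hi)
    rwa [map_sub, sub_eq_zero] at this
  have hcoeff : ∀ i n, i ≤ n → PowerSeries.coeff i (f n) = PowerSeries.coeff i (f i) := by
    intro i n hin
    induction n, hin using Nat.le_induction with
    | base => rfl
    | succ n hn ih => rw [hstep n i hn, ih]
  refine ⟨PowerSeries.mk fun i => PowerSeries.coeff i (f i), fun n => ?_⟩
  rw [toTrunc_apply, ← hf n, ← sub_eq_zero, ← map_sub, mk_eq_zero_iff, PowerSeries.X_pow_dvd_iff]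
  intro i hi
  rw [map_sub, PowerSeries.coeff_mk, hcoeff i n (Nat.le_of_lt_succ hi), sub_self]

theorem eq_zero_of_toTrunc_eq_zero {f : PowerSeries l} (hf : ∀ n, toTrunc p l n f = 0) : f = 0 := by
  ext n
  have := hf n
  rw [toTrunc_apply, mk_eq_zero_iff, PowerSeries.X_pow_dvd_iff] at this
  exact this n (Nat.lt_succ_self n)

/-- Coordinates in an `𝔽_p`-basis of `k` reduce limits in `R ⊗ k` to limits in `R`; finiteness of
the basis makes any family of coordinates admissible. -/
theorem equivFinsupp_coeffBaseChange {ι : Type*} [DecidableEq ι] (b : Module.Basis ι (ZMod p) k)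
    {R S : Type u} [CommRing R] [Algebra (ZMod p) R] [CommRing S] [Algebra (ZMod p) S]
    (f : R →ₐ[ZMod p] S) (a : CoeffRing p k R) (i : ι) :
    TensorProduct.equivFinsuppOfBasisRight b (coeffBaseChange k f a) i =
      f (TensorProduct.equivFinsuppOfBasisRight b a i) := by
  induction a using TensorProduct.induction_on with
  | zero => simp only [map_zero, Finsupp.zero_apply]
  | tmul r x =>
    rw [coeffBaseChange_tmul, TensorProduct.equivFinsuppOfBasisRight_apply_tmul_apply,
      TensorProduct.equivFinsuppOfBasisRight_apply_tmul_apply, map_smul]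
  | add x y hx hy => simp only [map_add, Finsupp.add_apply, hx, hy]

theorem exists_coeffBaseChange_toTrunc_eq [Finite k] {a : ∀ n, CoeffRing p k (TruncRing l n)}
    (ha : ∀ n, coeffBaseChange k (truncSucc p l n) (a (n + 1)) = a n) :
    ∃ c, ∀ n, coeffBaseChange k (toTrunc p l n) c = a n := by
  let b := Module.finBasis (ZMod p) k
  choose f hf using fun i => exists_toTrunc_eq (p := p)
    (y := fun n => TensorProduct.equivFinsuppOfBasisRight b (a n) i) (fun n => by
      rw [← equivFinsupp_coeffBaseChange, ha])
  refine ⟨(TensorProduct.equivFinsuppOfBasisRight b).symm (Finsupp.equivFunOnFinite.symm f),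
    fun n => (TensorProduct.equivFinsuppOfBasisRight b).injective (Finsupp.ext fun i => ?_)⟩
  rw [equivFinsupp_coeffBaseChange, LinearEquiv.apply_symm_apply]
  exact hf i n

theorem eq_zero_of_coeffBaseChange_toTrunc_eq_zero [Finite k] {a : CoeffRing p k (PowerSeries l)}
    (ha : ∀ n, coeffBaseChange k (toTrunc p l n) a = 0) : a = 0 := by
  let b := Module.finBasis (ZMod p) k
  refine (TensorProduct.equivFinsuppOfBasisRight b).injective (Finsupp.ext fun i => ?_)
  rw [map_zero, Finsupp.zero_apply]
  refine eq_zero_of_toTrunc_eq_zero (p := p) fun n => ?_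
  rw [← equivFinsupp_coeffBaseChange, ha, map_zero, Finsupp.zero_apply]

/-- The limit is taken coefficient by coefficient in `u`. For Laurent series this would fail, as the
pole orders could grow with `n`; hence the need for lattices. -/
theorem exists_integralBaseChange_toTrunc_eq [Finite k]
    {s : ∀ n, IntegralRing p k (TruncRing l n)}
    (hs : ∀ n, integralBaseChange k (truncSucc p l n) (s (n + 1)) = s n) :
    ∃ t, ∀ n, integralBaseChange k (toTrunc p l n) t = s n := by
  choose c hc using fun i : ℕ => exists_coeffBaseChange_toTrunc_eq
    (a := fun n => PowerSeries.coeff i (s n)) (fun n => by rw [← hs n, PowerSeries.coeff_map])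
  refine ⟨PowerSeries.mk c, fun n => PowerSeries.ext fun i => ?_⟩
  rw [PowerSeries.coeff_map, PowerSeries.coeff_mk, hc]

theorem eq_of_integralBaseChange_toTrunc_eq [Finite k]
    {s t : IntegralRing p k (PowerSeries l)}
    (h : ∀ n, integralBaseChange k (toTrunc p l n) s = integralBaseChange k (toTrunc p l n) t) :
    s = t := by
  ext i
  rw [← sub_eq_zero]
  refine eq_zero_of_coeffBaseChange_toTrunc_eq_zero fun n => ?_
  have := congrArg (PowerSeries.coeff i) (h n)
  rw [PowerSeries.coeff_map, PowerSeries.coeff_map] at this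
  rw [map_sub, this, sub_self]

theorem laurentBaseChange_truncSucc_toTrunc (n : ℕ) (x : LaurentRing p k (PowerSeries l)) :
    laurentBaseChange p k (truncSucc p l n) (laurentBaseChange p k (toTrunc p l (n + 1)) x) =
      laurentBaseChange p k (toTrunc p l n) x := by
  have h : ∀ a, coeffBaseChange k (truncSucc p l n) (coeffBaseChange k (toTrunc p l (n + 1)) a) =
      coeffBaseChange k (toTrunc p l n) a := fun a => by
    induction a using TensorProduct.induction_on with
    | zero => simp only [map_zero]
    | tmul r x => rfl
    | add x y hx hy => simp only [map_add, hx, hy]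
  exact HahnSeries.ext (funext fun i => h _)

end Limit

/-! ### Free `φ`-modules given by matrices -/

namespace PhiModule

section Free

variable (p : ℕ) [Fact p.Prime] (k : Type u) [Field k] [Algebra (ZMod p) k] {d : ℕ}
  {R S : Type u} [CommRing R] [Algebra (ZMod p) R] [CommRing S] [Algebra (ZMod p) S]

theorem isFpqcLocallyFree_pi : IsFpqcLocallyFree p k d R (Fin d → LaurentRing p k R) :=
  ⟨R, inferInstance, inferInstance, AlgHom.id (ZMod p) R,
    RingHom.FaithfullyFlat.of_bijective Function.bijective_id, ⟨ScalarExtension.piEquiv _ (Fin d)⟩⟩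

variable {p k}

/-- Multiplication by an invertible matrix. -/
def mulVecEquiv {A : Type*} [CommRing A] {X Z : Matrix (Fin d) (Fin d) A} (hXZ : X * Z = 1)
    (hZX : Z * X = 1) : (Fin d → A) ≃ₗ[A] (Fin d → A) :=
  LinearEquiv.ofLinearMap X.mulVecLin Z.mulVecLin
    (by rw [← Matrix.mulVecLin_mul, hXZ, Matrix.mulVecLin_one])
    (by rw [← Matrix.mulVecLin_mul, hZX, Matrix.mulVecLin_one])

/-- The free `φ`-module with a given invertible matrix. -/
def ofMatrix {X Z : Matrix (Fin d) (Fin d) (LaurentRing p k R)} (hXZ : X * Z = 1) (hZX : Z * X = 1) :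
    PhiModule p k d R where
  carrier := Fin d → LaurentRing p k R
  locallyFree := isFpqcLocallyFree_pi p k
  Phi := (ScalarExtension.piEquiv (phi p k R) (Fin d)).trans (mulVecEquiv hXZ hZX)

theorem ofMatrix_frob {X Z : Matrix (Fin d) (Fin d) (LaurentRing p k R)} (hXZ : X * Z = 1)
    (hZX : Z * X = 1) (m : Fin d → LaurentRing p k R) :
    (ofMatrix hXZ hZX).frob m = X.mulVec fun i => phi p k R (m i) := by
  have h := ScalarExtension.piEquiv_tmul (phi p k R) (Fin d) 1 m
  simp only [one_mul] at h
  exact congrArg X.mulVec h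

/-- The base change of a free `φ`-module is isomorphic to any `φ`-module which has a basis with the
corresponding matrix. -/
def ofMatrixBaseChangeIso (f : R →ₐ[ZMod p] S)
    {X Z : Matrix (Fin d) (Fin d) (LaurentRing p k R)} (hXZ : X * Z = 1) (hZX : Z * X = 1)
    {N : PhiModule p k d S} (b : Module.Basis (Fin d) (LaurentRing p k S) N.carrier)
    (hb : ∀ j, N.frob (b j) = ∑ i, laurentBaseChange p k f (X i j) • b i) :
    BaseChangeIso f (ofMatrix hXZ hZX) N where
  iso := (ScalarExtension.piEquiv (laurentBaseChange p k f) (Fin d)).trans b.equivFun.symm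
  comm := by
    have key : ∀ m : Fin d → LaurentRing p k R,
        ((ScalarExtension.piEquiv (laurentBaseChange p k f) (Fin d)).trans b.equivFun.symm)
          (ScalarExtension.tmul (laurentBaseChange p k f) 1 m) =
        ∑ i, laurentBaseChange p k f (m i) • b i := fun m => by
      rw [LinearEquiv.trans_apply, ScalarExtension.piEquiv_tmul, Module.Basis.equivFun_symm_apply]
      simp only [one_mul]
    intro m
    refine (key _).trans (Eq.trans ?_ (congrArg N.frob (key m)).symm)
    refine (congrArg (fun z : Fin d → LaurentRing p k R => ∑ i, laurentBaseChange p k f (z i) • b i)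
      (ofMatrix_frob hXZ hZX m)).trans ?_
    rw [frob_sum]
    simp only [frob_smul, hb, Matrix.mulVec, dotProduct, map_sum, map_mul, Finset.sum_smul,
      Finset.smul_sum, smul_smul, laurentBaseChange_phi]
    rw [Finset.sum_comm]
    exact Finset.sum_congr rfl fun i _ => Finset.sum_congr rfl fun j _ => by rw [mul_comm]

theorem ofMatrixBaseChangeIso_red (f : R →ₐ[ZMod p] S)
    {X Z : Matrix (Fin d) (Fin d) (LaurentRing p k R)} (hXZ : X * Z = 1) (hZX : Z * X = 1)
    {N : PhiModule p k d S} (b : Module.Basis (Fin d) (LaurentRing p k S) N.carrier)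
    (hb : ∀ j, N.frob (b j) = ∑ i, laurentBaseChange p k f (X i j) • b i)
    (m : Fin d → LaurentRing p k R) :
    (ofMatrixBaseChangeIso f hXZ hZX b hb).red m = ∑ i, laurentBaseChange p k f (m i) • b i := by
  change b.equivFun.symm (ScalarExtension.piEquiv (laurentBaseChange p k f) (Fin d)
    (ScalarExtension.tmul (laurentBaseChange p k f) 1 m)) = _
  rw [ScalarExtension.piEquiv_tmul, Module.Basis.equivFun_symm_apply]
  simp only [one_mul]

end Free

section Span

variable {p : ℕ} [Fact p.Prime] {k : Type u} [Field k] [Algebra (ZMod p) k] {d : ℕ}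
  {R : Type u} [CommRing R] [Algebra (ZMod p) R] {M : PhiModule p k d R}

theorem exists_phi_algebraMap_eq (s : IntegralRing p k R) :
    ∃ t, algebraMap (IntegralRing p k R) (LaurentRing p k R) t =
      phi p k R (algebraMap (IntegralRing p k R) (LaurentRing p k R) s) := by
  refine exists_algebraMap_powerSeries_eq fun n hn => ?_
  by_cases h : (p : ℤ) ∣ n
  · obtain ⟨m, rfl⟩ := h
    rw [phi_coeff_mul, algebraMap_powerSeries_coeff_of_neg, map_zero]
    have := (Nat.cast_nonneg p : (0 : ℤ) ≤ p)
    exact neg_of_mul_neg_right hn this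
  · exact phi_coeff_of_not_dvd _ _ _ _ h

theorem phiImage_span_le {ι : Type*} [Fintype ι] (w : ι → M.carrier) :
    M.phiImage (Submodule.span (IntegralRing p k R) (Set.range w)) ≤
      Submodule.span (IntegralRing p k R) (Set.range fun i => M.frob (w i)) := by
  refine Submodule.span_le.2 ?_
  rintro _ ⟨m, hm, rfl⟩
  obtain ⟨c, rfl⟩ := (Submodule.mem_span_range_iff_exists_fun _).1 hm
  rw [frob_sum]
  refine sum_mem fun i _ => ?_
  obtain ⟨t, ht⟩ := exists_phi_algebraMap_eq (c i)
  rw [integral_smul_def, frob_smul, ← ht, ← integral_smul_def]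
  exact Submodule.smul_mem _ _ (Submodule.subset_span ⟨i, rfl⟩)

theorem integral_coeff_unique {w : Fin d → M.carrier}
    (hw : LinearIndependent (LaurentRing p k R) w) {a b : Fin d → IntegralRing p k R}
    (h : ∑ i, a i • w i = ∑ i, b i • w i) : a = b := by
  funext i
  refine algebraMap_powerSeries_injective ?_
  exact Fintype.linearIndependent_iffₛ.1 hw
    (fun i => algebraMap (IntegralRing p k R) (LaurentRing p k R) (a i))
    (fun i => algebraMap (IntegralRing p k R) (LaurentRing p k R) (b i)) h i

end Span

end PhiModule

end

/-! ### Construction of the algebraic `φ`-module -/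

open PhiModule in
theorem mainTheorem8 (p : ℕ) [Fact p.Prime]
    (k : Type u) [Field k] [Finite k] [Algebra (ZMod p) k]
    (l : Type u) [Field l] [Finite l] [Algebra (ZMod p) l] [Algebra k l]
    (d e : ℕ) (M' : FormalPoint p l k d)
    (hM' : ∀ n : ℕ, ∃ L : Submodule (IntegralRing p k (TruncRing l n)) (M'.obj n).carrier,
      (M'.obj n).IsLatticeOfHeightLEOne e L) :
    ∃ (M : PhiModule p k d (PowerSeries l))
      (g : ∀ n : ℕ, PhiModule.BaseChangeIso (toTrunc p l n) M (M'.obj n)),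
      ∀ (n : ℕ) (m : M.carrier), (M'.trans n).red ((g (n + 1)).red m) = (g n).red m := by
  obtain ⟨w, hw, hwred⟩ := FormalPoint.exists_compatible_generators hM'
  have hL := fun n => FormalPoint.isLattice_stableLattice hM' n
  have htop := fun n => (hL n).span_laurent_eq_top (hw n)
  have hli := fun n => linearIndependent_of_span_eq_top (htop n)
  have hmem : ∀ n i, w n i ∈ M'.stableLattice e n := fun n i =>
    hw n ▸ Submodule.subset_span ⟨i, rfl⟩
  -- the matrices of the Frobenius maps and their inverses
  have hX : ∀ n j, ∃ c : Fin d → IntegralRing p k (TruncRing l n),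
      ∑ i, c i • w n i = (M'.obj n).frob (w n j) := fun n j => by
    refine (Submodule.mem_span_range_iff_exists_fun _).1 ?_
    rw [hw]
    exact (hL n).frob_mem (hmem n j)
  have hY : ∀ n j, ∃ c : Fin d → IntegralRing p k (TruncRing l n),
      ∑ i, c i • (M'.obj n).frob (w n i) =
        (PowerSeries.X ^ e : IntegralRing p k (TruncRing l n)) • w n j := fun n j => by
    refine (Submodule.mem_span_range_iff_exists_fun _).1 (phiImage_span_le (w n) ?_)
    rw [hw]
    exact (hL n).pow_smul_mem _ (hmem n j)
  choose X hX using hX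
  choose Y hY using hY
  -- The span contains `u^e w_j` and `u^e` is a unit. So the `Φ(1 ⊗ w_i)` also form a basis, and the
  -- coefficients `Y` are unique and therefore compatible in `n`.
  have hfrobtop : ∀ n, Submodule.span (LaurentRing p k (TruncRing l n))
      (Set.range fun i => (M'.obj n).frob (w n i)) = ⊤ := fun n => by
    rw [eq_top_iff, ← htop n]
    refine Submodule.span_le.2 ?_
    rintro _ ⟨j, rfl⟩
    refine (Submodule.smul_mem_iff_of_isUnit _ (isUnit_algebraMap_X_pow e)).1 ?_
    rw [← integral_smul_def, ← hY]
    exact sum_mem fun i _ => Submodule.smul_mem _ _ (Submodule.subset_span ⟨i, rfl⟩)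
  have hfrobli := fun n => linearIndependent_of_span_eq_top (hfrobtop n)
  have hXred : ∀ i j n, integralBaseChange k (truncSucc p l n) (X (n + 1) j i) = X n j i := by
    intro i j n
    refine congrFun (integral_coeff_unique (hli n)
      (a := fun i => integralBaseChange k (truncSucc p l n) (X (n + 1) j i)) ?_) i
    rw [hX, ← hwred, ← BaseChangeIso.red_frob, ← hX, BaseChangeIso.red_sum]
    simp only [BaseChangeIso.red_integral_smul, hwred]
  have hYred : ∀ i j n, integralBaseChange k (truncSucc p l n) (Y (n + 1) j i) = Y n j i := by
    intro i j n
    refine congrFun (integral_coeff_unique (hfrobli n)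
      (a := fun i => integralBaseChange k (truncSucc p l n) (Y (n + 1) j i)) ?_) i
    rw [hY, ← hwred, ← BaseChangeIso.red_X_pow_smul, ← hY, BaseChangeIso.red_sum]
    simp only [BaseChangeIso.red_integral_smul, BaseChangeIso.red_frob, hwred]
  -- The indices are exchanged: `X n j i` is the coefficient of `w_i` in `Φ(1 ⊗ w_j)`, which is the
  -- matrix entry in row `i` and column `j`.
  choose X' hX' using fun i j => exists_integralBaseChange_toTrunc_eq
    (s := fun n => X n j i) (hXred i j)
  choose Y' hY' using fun i j => exists_integralBaseChange_toTrunc_eq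
    (s := fun n => Y n j i) (hYred i j)
  -- This is checked modulo every `ϖ^{n+1}`, by inserting the expansion of `Φ(1 ⊗ w_t)` into that of
  -- `u^e w_j` and comparing coefficients.
  have hXY : ∀ i j, ∑ t, X' i t * Y' t j = if i = j then PowerSeries.X ^ e else 0 := by
    intro i j
    refine eq_of_integralBaseChange_toTrunc_eq fun n => ?_
    rw [map_sum]
    simp only [map_mul, hX', hY']
    have h1 : (fun i => ∑ t, X n t i * Y n j t) =
        fun i => if i = j then (PowerSeries.X ^ e : IntegralRing p k (TruncRing l n)) else 0 := by
      refine integral_coeff_unique (hli n) (Eq.trans (b := (PowerSeries.X ^ e :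
        IntegralRing p k (TruncRing l n)) • w n j) ?_ ?_)
      · rw [← hY]
        simp only [← hX, Finset.smul_sum, Finset.sum_smul, smul_smul]
        rw [Finset.sum_comm]
        exact Finset.sum_congr rfl fun i _ => Finset.sum_congr rfl fun t _ => by rw [mul_comm]
      · rw [Finset.sum_eq_single j]
        · rw [if_pos rfl]
        · intro i _ hij
          rw [if_neg hij]
          exact zero_smul (IntegralRing p k (TruncRing l n)) (w n i)
        · simp
    rw [congrFun h1 i]
    split_ifs
    · rw [map_pow, PowerSeries.map_X]
    · rw [map_zero]
  -- the algebraic `φ`-module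
  let α := algebraMap (IntegralRing p k (PowerSeries l)) (LaurentRing p k (PowerSeries l))
  obtain ⟨v, hv⟩ := isUnit_algebraMap_X_pow (A := CoeffRing p k (PowerSeries l)) e
  let XB : Matrix (Fin d) (Fin d) (LaurentRing p k (PowerSeries l)) := fun i j => α (X' i j)
  let Z : Matrix (Fin d) (Fin d) (LaurentRing p k (PowerSeries l)) :=
    fun i j => α (Y' i j) * (↑v⁻¹ : LaurentRing p k (PowerSeries l))
  have hXZ : XB * Z = 1 := by
    ext i j : 2
    rw [Matrix.mul_apply, Matrix.one_apply]
    simp only [XB, Z, ← mul_assoc, ← map_mul]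
    rw [← Finset.sum_mul, ← map_sum, hXY]
    split_ifs
    · rw [← hv, Units.mul_inv]
    · rw [map_zero, zero_mul]
  -- For square matrices over a commutative ring a one-sided inverse is two-sided, so the relation
  -- `Y X = u^e` need not be proved separately.
  have hZX : Z * XB = 1 := mul_eq_one_comm.1 hXZ
  let b : ∀ n, Module.Basis (Fin d) (LaurentRing p k (TruncRing l n)) (M'.obj n).carrier :=
    fun n => Module.Basis.mk (hli n) (htop n).ge
  have hbw : ∀ n i, b n i = w n i := fun n i => Module.Basis.mk_apply _ _ i
  have hb : ∀ n j, (M'.obj n).frob (b n j) =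
      ∑ i, laurentBaseChange p k (toTrunc p l n) (XB i j) • b n i := fun n j => by
    simp only [hbw, XB, α, laurentBaseChange_algebraMap, hX', ← hX]
    rfl
  refine ⟨ofMatrix hXZ hZX, fun n => ofMatrixBaseChangeIso (toTrunc p l n) hXZ hZX (b n) (hb n),
    fun n m => ?_⟩
  refine (congrArg (M'.trans n).red (ofMatrixBaseChangeIso_red _ hXZ hZX _ (hb (n + 1)) m)).trans
    (Eq.trans ?_ (ofMatrixBaseChangeIso_red _ hXZ hZX _ (hb n) m).symm)
  rw [BaseChangeIso.red_sum]
  refine Finset.sum_congr rfl fun i _ => ?_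
  rw [BaseChangeIso.red_smul, laurentBaseChange_truncSucc_toTrunc, hbw, hbw, hwred]
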